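/- **Setting.** Let $\theta_1,\theta_2,\dots$ be real random variables and, for every $T\in\mathbb N$, let $\varepsilon_{1,T},\varepsilon_{2,T},\dots$ be real random variables such that for each $T$ the vectors $(\theta_i,\varepsilon_{i,T})$, $i=1,2,\dots$, are independent and identically distributed (no restriction is placed on the dependence between $\theta_i$ and $\varepsilon_{i,T}$). Fix $p>0$ and put $\vartheta_{i,T}=\theta_i+T^{-p}\varepsilon_{i,T}$. Let $\theta_{1,N}\le\dots\le\theta_{N,N}$ and $\vartheta_{1,N,T}\le\dots\le\vartheta_{N,N,T}$ be the order statistics of $\theta_1,\dots,\theta_N$ and of $\vartheta_{1,T},\dots,\vartheta_{N,T}$. Let $F$ be the distribution function of $\theta_i$ and $G_T$ that of $\varepsilon_{i,T}$. For a distribution function $H$ let $H^{-1}(q)=\inf\{x: H(x)\ge q\}$ for $0<q\le 1$ (so $H^{-1}(1)\le\infty$ is the right endpoint) and let $H^{-1}(0)$ be the left endpoint $\inf\{x:H(x)>0\}$. **Assumptions.** (a) (von Mises condition) $F$ is continuous; in some left neighbourhood of $F^{-1}(1)\le\infty$ it is twice differentiable with positive density $f=F'$; and for some $\gamma\in\mathbb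 R$, $\lim_{t\uparrow F^{-1}(1)}\left(\frac{1-F}{f}\right)'(t)=\gamma$. (b) $f$ is non-increasing or non-decreasing in some left neighbourhood of $F^{-1}(1)$. (c) $k=k(N)$ are natural numbers with $k\to\infty$ and $k/N\to0$ as $N\to\infty$. **Tail equivalence.** Write $c_{N,k}=\frac Nk\,U_F'\!\left(\frac Nk\right)$ with $U_F(x)=\left(\frac1{1-F}\right)^{-1}(x)=F^{-1}(1-1/x)$, and let $U_{k,N}$ be the $k$-th smallest of $N$ independent uniform random variables on $[0,1]$. Say that the *IVT conditions hold at $k$* if for some $\epsilon\in(0,1)$, as $N,T\to\infty$, $$\sup_{u\in[0,\epsilon]}\frac{\sqrt k}{c_{N,k}}\Big(F^{-1}(1-U_{k,N}-u)-F^{-1}(1-U_{k,N})+\tfrac1{T^p}G_T^{-1}(u)\Big)\xrightarrow{\;p\;}0,$$ $$\inf_{u\in[0,U_{k,N}]}\frac{\sqrt k}{c_{N,k}}\Big(F^{-1}(1-U_{k,N}+u)-F^{-1}(1-U_{k,N})+\tfrac1{T^p}G_T^{-1}(1-u)\Big)\xrightarrow{\;p\;}0.$$ **Theorem.** (1) As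 $N\to\infty$, $$\frac{\theta_{N-k,N}-F^{-1}(1-k/N)}{\theta_{N-k,N}-\theta_{N-k-\lfloor\sqrt k\rfloor,N}}\Rightarrow N(0,1).$$ (2) If in addition the IVT conditions hold at $k$ and at $k+\lfloor\sqrt k\rfloor$ (in place of $k$), then as $N,T\to\infty$, $$\frac{\vartheta_{N-k,N,T}-F^{-1}(1-k/N)}{\vartheta_{N-k,N,T}-\vartheta_{N-k-\lfloor\sqrt k\rfloor,N,T}}\Rightarrow N(0,1).$$ Here $N,T\to\infty$ refers to any regime in which both tend to infinity (for example the unrestricted double limit, or $T=T(N)\to\infty$, or any sequence of pairs $(N_j,T_j)$ with $N_j,T_j\to\infty$); hypotheses and conclusion of (2) are taken in the same regime. -/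

import Mathlib

open MeasureTheory ProbabilityTheory Filter Set
open scoped Topology

noncomputable section

/-- The quantile function `F⁻¹(p) = inf {x : F x ≥ p}` of a distribution function `F`, as an
extended real number (`F⁻¹(1) = ∞` is possible). The restriction `0 < F x` is void for `p > 0`; for
`p ≤ 0` it makes the value the left endpoint of the distribution, so that `F⁻¹(0)` and `F⁻¹(1)` are
the two endpoints. -/
def quantile (F : ℝ → ℝ) (p : ℝ) : EReal :=
  sInf ((fun x : ℝ => (x : EReal)) '' {x : ℝ | 0 < F x ∧ p ≤ F x})

/-- The right endpoint `F⁻¹(1)`, possibly `∞`. -/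
def rightEndpoint (F : ℝ → ℝ) : EReal := quantile F 1

/-- The filter of left neighbourhoods of `F⁻¹(1)`: this is `𝓝[<] x` when `F⁻¹(1) = x` is finite, and
`atTop` when `F⁻¹(1) = ∞`. -/
def leftNhdsEndpoint (F : ℝ → ℝ) : Filter ℝ :=
  comap (fun x : ℝ => (x : EReal)) (𝓝[<] (rightEndpoint F))

/-- The first order von Mises condition with extreme value index `γ`: `F` is continuous, in some
left neighbourhood of `F⁻¹(1)` it is twice differentiable with positive density `f = F'`, and
`((1 - F) / f)'(t) → γ` as `t ↑ F⁻¹(1)`. -/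
structure VonMises (F : ℝ → ℝ) (γ : ℝ) : Prop where
  continuous : Continuous F
  differentiable : ∀ᶠ t in leftNhdsEndpoint F, DifferentiableAt ℝ F t
  differentiable_density : ∀ᶠ t in leftNhdsEndpoint F, DifferentiableAt ℝ (deriv F) t
  density_pos : ∀ᶠ t in leftNhdsEndpoint F, 0 < deriv F t
  tendsto : Tendsto (deriv fun x => (1 - F x) / deriv F x) (leftNhdsEndpoint F) (𝓝 γ)

/-- The density `f = F'` is non-increasing or non-decreasing in some left neighbourhood of
`F⁻¹(1)`. -/
def DensityEventuallyMonotone (F : ℝ → ℝ) : Prop :=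
  ∃ s ∈ leftNhdsEndpoint F, MonotoneOn (deriv F) s ∨ AntitoneOn (deriv F) s

/-- `orderStat x j` is the `j`-th smallest of `x₁, …, x_N`, for `1 ≤ j ≤ N`: the least real `t`
such that at least `j` of the values are `≤ t`. -/
def orderStat {N : ℕ} (x : Fin N → ℝ) (j : ℕ) : ℝ :=
  sInf {t : ℝ | j ≤ (Finset.univ.filter fun i => x i ≤ t).card}

/-- The inverse `U_F = (1 / (1 - F))⁻¹` of the function `1 / (1 - F)`: for `x > 1`, the least `y`
with `1 / (1 - F y) ≥ x`, that is, with `F y ≥ 1 - 1 / x`. -/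
def tailQuantile (F : ℝ → ℝ) (x : ℝ) : ℝ := (quantile F (1 - 1 / x)).toReal

/-- The scale `c_N = (N / k) * U_F'(N / k)`. -/
def ivtScale (F : ℝ → ℝ) (N k : ℕ) : ℝ :=
  ((N : ℝ) / k) * deriv (tailQuantile F) ((N : ℝ) / k)

/-- The law of `N` independent random variables that are uniformly distributed on `[0, 1]`. -/
def uniformSample (N : ℕ) : Measure (Fin N → ℝ) :=
  Measure.pi fun _ => volume.restrict (Icc (0 : ℝ) 1)

/-- The left-hand side of the supremum tail equivalence condition:
`sup_{u ∈ [0, ε]} (√k / c_N) (F⁻¹(1 - v - u) - F⁻¹(1 - v) + T^(-p) G⁻¹(u))`. -/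
def tailSup (F G : ℝ → ℝ) (p ε : ℝ) (N T k : ℕ) (v : ℝ) : EReal :=
  ⨆ u ∈ Icc (0 : ℝ) ε, ((√(k : ℝ) / ivtScale F N k : ℝ) : EReal) *
    (quantile F (1 - v - u) - quantile F (1 - v)
      + ((1 / (T : ℝ) ^ p : ℝ) : EReal) * quantile G u)

/-- The left-hand side of the infimum tail equivalence condition:
`inf_{u ∈ [0, v]} (√k / c_N) (F⁻¹(1 - v + u) - F⁻¹(1 - v) + T^(-p) G⁻¹(1 - u))`. -/
def tailInf (F G : ℝ → ℝ) (p : ℝ) (N T k : ℕ) (v : ℝ) : EReal :=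
  ⨅ u ∈ Icc (0 : ℝ) v, ((√(k : ℝ) / ivtScale F N k : ℝ) : EReal) *
    (quantile F (1 - v + u) - quantile F (1 - v)
      + ((1 / (T : ℝ) ^ p : ℝ) : EReal) * quantile G (1 - u))

/-- The tail equivalence conditions for the intermediate order `k = k(N)`, as `(N, T)` tends to
infinity along the filter `l`: evaluated at `v = U_{k,N}`, the `k`-th smallest of `N` independent
uniform variables, the supremum (for some fixed `ε ∈ (0, 1)`) and the infimum tend to zero in
probability. Here `G T` is the distribution function of the noise for sample size `T`. -/
structure IVTTailEquivalence (F : ℝ → ℝ) (G : ℕ → ℝ → ℝ) (p : ℝ) (k : ℕ → ℕ)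
    (l : Filter (ℕ × ℕ)) : Prop where
  sup : ∃ ε ∈ Ioo (0 : ℝ) 1, ∀ δ : ℝ, 0 < δ → Tendsto
    (fun q : ℕ × ℕ => uniformSample q.1
      {x | ENNReal.ofReal δ ≤ (tailSup F (G q.2) p ε q.1 q.2 (k q.1)
        (orderStat x (k q.1))).abs}) l (𝓝 0)
  inf : ∀ δ : ℝ, 0 < δ → Tendsto
    (fun q : ℕ × ℕ => uniformSample q.1
      {x | ENNReal.ofReal δ ≤ (tailInf F (G q.2) p q.1 q.2 (k q.1)
        (orderStat x (k q.1))).abs}) l (𝓝 0)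

/-- The self-normalised statistic
`(x_{N-k,N} - F⁻¹(1 - k/N)) / (x_{N-k,N} - x_{N-k-⌊√k⌋,N})` of a sample `x` of size `N`. -/
def ivtStatistic (F : ℝ → ℝ) {N : ℕ} (x : Fin N → ℝ) (k : ℕ) : ℝ :=
  (orderStat x (N - k) - (quantile F (1 - (k : ℝ) / N)).toReal) /
    (orderStat x (N - k) - orderStat x (N - k - ⌊√(k : ℝ)⌋₊))

end

/-! Everything is read off exceedance counts. Write U = `tailQuantile F` and c = (N/k) U'(N/k), let
t(y) be the level exceeded with probability (k - y√k)/N, and let B be the number of exceedances of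
t(0), centred by k and divided by √k. The count is binomial with success probability k/N → 0 and k →
∞, so B ⇒ N(0,1). The number of points between t(0) and t(y) has mean |y|√k and no larger variance,
which is o(k); hence the normalised count above t(y) is B - y + o_p(1)
(`tendsto_measure_exceedance_sub`).

With g = (1 - F)/f one has x U'(x) = g(U(x)), and log g(U(e^τ)) has derivative g'(U(e^τ)) in τ,
which the von Mises condition keeps bounded. So x U'(x) hardly changes while log x hardly changes,
and (t(y) - t(0)) √k/c → y (`VonMises.tendsto_tailLevel`). Since θ_{N-j,N} ≤ t exactly when at most
j points exceed t, inverting the counts gives (θ_{N-k-m,N} - t(0)) √k/c = B - x + o_p(1) whenever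
m/√k → x (`tendsto_measure_orderStat_sub`). Taking x = 0 and x = 1, the ratio in (1) is (B +
o_p(1))/(1 + o_p(1)); the scale c cancels.

For (2) it suffices that, for every η > 0, all but o_p(√k) of the noise terms T^(-p) ε are at most η
c/√k in modulus: noisy counts are then squeezed between noiseless counts at nearby levels, whatever
the dependence between θ and ε. Near-optimal points u₁, u₂ of the tail supremum and infimum satisfy
T^(-p) G⁻¹(u₁) > -δc/√k and T^(-p) G⁻¹(1 - u₂) < δc/√k, while the increments of F⁻¹ over u₁ and u₂
are below 2δc/√k. Such increments grow at least linearly, so u₁ + u₂ = O(δ√k/N); the expected number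
of large noise terms is O(δ√k), and Markov's inequality concludes
(`IVTTailEquivalence.tendsto_measure_noise`). -/

/-! ### Counts of sample points and order statistics -/

open Classical in
/-- The number of values of the sample `x` that lie in the set `s`. -/
noncomputable def countIn {N : ℕ} (x : Fin N → ℝ) (s : Set ℝ) : ℕ :=
  (Finset.univ.filter fun i => x i ∈ s).card

lemma countIn_eq_sum {N : ℕ} (x : Fin N → ℝ) (s : Set ℝ) :
    (countIn x s : ℝ) = ∑ i, s.indicator (fun _ => (1 : ℝ)) (x i) := by
  classical
  simp [countIn, Set.indicator_apply, Finset.sum_boole]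

lemma countIn_union_disjoint {N : ℕ} (x : Fin N → ℝ) {s t : Set ℝ} (h : Disjoint s t) :
    countIn x (s ∪ t) = countIn x s + countIn x t := by
  classical
  unfold countIn
  rw [← Finset.card_union_of_disjoint]
  · congr 1; ext i; simp
  · rw [Finset.disjoint_filter]
    intro i _ h1 h2
    exact Set.disjoint_left.1 h h1 h2

lemma countIn_Iic_add_Ioi {N : ℕ} (x : Fin N → ℝ) (t : ℝ) :
    countIn x (Iic t) + countIn x (Ioi t) = N := by
  rw [← countIn_union_disjoint x (t := Ioi t) (s := Iic t)
    (Set.disjoint_left.2 fun y h1 h2 => not_lt.2 (mem_Iic.1 h1) (mem_Ioi.1 h2))]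
  simp [countIn]

lemma countIn_Ioi_eq_add {N : ℕ} (x : Fin N → ℝ) {a b : ℝ} (h : a ≤ b) :
    countIn x (Ioi a) = countIn x (Ioc a b) + countIn x (Ioi b) := by
  rw [← countIn_union_disjoint x (s := Ioc a b) (t := Ioi b)
    (Set.disjoint_left.2 fun y h1 h2 => not_lt.2 (mem_Ioc.1 h1).2 (mem_Ioi.1 h2)),
    Ioc_union_Ioi_eq_Ioi h]

/-- The infimum defining `orderStat` is attained: the set is closed, nonempty because j ≤ N, and
bounded below because 1 ≤ j. This turns every statement about order statistics into one about
counts. -/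
lemma orderStat_le_iff {N : ℕ} (x : Fin N → ℝ) {j : ℕ} (hj : 1 ≤ j) (hjN : j ≤ N) (t : ℝ) :
    orderStat x j ≤ t ↔ j ≤ countIn x (Iic t) := by
  classical
  have hc : ∀ t, (Finset.univ.filter fun i => x i ≤ t).card = countIn x (Iic t) := by
    intro t; unfold countIn; congr
  -- Closedness: a finite union, over the j-element index sets, of intersections of closed
  -- half-lines.
  have hset : {t : ℝ | j ≤ (Finset.univ.filter fun i => x i ≤ t).card} =
      ⋃ s ∈ (Finset.univ : Finset (Fin N)).powersetCard j, ⋂ i ∈ s, Ici (x i) := by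
    ext t
    simp only [mem_ofPred_eq, mem_iUnion, mem_iInter, mem_Ici, Finset.mem_powersetCard,
      Finset.subset_univ, true_and, exists_prop]
    constructor
    · intro h
      obtain ⟨s, hs, hsc⟩ := Finset.exists_subset_card_eq h
      exact ⟨s, hsc, fun i hi => (Finset.mem_filter.1 (hs hi)).2⟩
    · rintro ⟨s, hs, h⟩
      rw [← hs]
      exact Finset.card_le_card fun i hi => Finset.mem_filter.2 ⟨Finset.mem_univ _, h i hi⟩
  have hclosed : IsClosed {t : ℝ | j ≤ (Finset.univ.filter fun i => x i ≤ t).card} := by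
    rw [hset]
    refine isClosed_biUnion_finset fun s _ => isClosed_biInter fun i _ => isClosed_Ici
  have hmono : ∀ a b : ℝ, a ≤ b → countIn x (Iic a) ≤ countIn x (Iic b) := by
    intro a b hab
    exact Finset.card_le_card fun i hi => by
      simp only [mem_Iic, Finset.mem_filter, Finset.mem_univ, true_and] at hi ⊢
      exact hi.trans hab
  have hne : {t : ℝ | j ≤ (Finset.univ.filter fun i => x i ≤ t).card}.Nonempty := by
    obtain ⟨M, hM⟩ := (Set.finite_range x).bddAbove
    refine ⟨M, ?_⟩
    have : (Finset.univ.filter fun i => x i ≤ M) = Finset.univ := by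
      ext i; simpa using hM (mem_range_self i)
    simp [this, hjN]
  have hbdd : BddBelow {t : ℝ | j ≤ (Finset.univ.filter fun i => x i ≤ t).card} := by
    obtain ⟨m, hm⟩ := (Set.finite_range x).bddBelow
    refine ⟨m, fun t ht => ?_⟩
    have h1 : 0 < (Finset.univ.filter fun i => x i ≤ t).card := lt_of_lt_of_le hj ht
    obtain ⟨i, hi⟩ := Finset.card_pos.1 h1
    exact (hm (mem_range_self i)).trans (Finset.mem_filter.1 hi).2
  constructor
  · intro h
    have := hclosed.csInf_mem hne hbdd
    rw [mem_ofPred_eq, hc] at this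
    exact this.trans (hmono _ _ h)
  · intro h
    exact csInf_le hbdd (by rw [mem_ofPred_eq, hc]; exact h)

lemma orderStat_sub_le_iff {N : ℕ} (x : Fin N → ℝ) {j : ℕ} (hj : j < N) (t : ℝ) :
    orderStat x (N - j) ≤ t ↔ countIn x (Ioi t) ≤ j := by
  rw [orderStat_le_iff x (by omega) (by omega)]
  have := countIn_Iic_add_Ioi x t
  omega

lemma measurable_countIn {Ω : Type*} [MeasurableSpace Ω] {N : ℕ} {X : Fin N → Ω → ℝ}
    (hX : ∀ i, Measurable (X i)) {s : Set ℝ} (hs : MeasurableSet s) :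
    Measurable fun ω => (countIn (fun i => X i ω) s : ℝ) := by
  simp_rw [countIn_eq_sum]
  exact Finset.measurable_sum _ fun i _ => (measurable_const.indicator hs).comp (hX i)

lemma measurable_orderStat {Ω : Type*} [MeasurableSpace Ω] {N : ℕ} {X : Fin N → Ω → ℝ}
    (hX : ∀ i, Measurable (X i)) (j : ℕ) :
    Measurable fun ω => orderStat (fun i => X i ω) j := by
  rcases Nat.eq_zero_or_pos j with rfl | hj
  -- Outside 1 ≤ j ≤ N the set is all of ℝ or empty, and its infimum is 0 by convention.
  · have : (fun ω => orderStat (fun i => X i ω) 0) = fun _ => (0 : ℝ) := by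
      ext ω; simp [orderStat]
    rw [this]; exact measurable_const
  rcases le_or_gt j N with hjN | hjN
  · refine measurable_of_Iic fun t => ?_
    have : (fun ω => orderStat (fun i => X i ω) j) ⁻¹' Iic t =
        {ω | (j : ℝ) ≤ (countIn (fun i => X i ω) (Iic t) : ℝ)} := by
      ext ω
      simp only [mem_preimage, mem_Iic, mem_ofPred_eq, Nat.cast_le]
      exact orderStat_le_iff _ hj hjN t
    rw [this]
    exact measurableSet_le measurable_const (measurable_countIn hX measurableSet_Iic)
  · have : (fun ω => orderStat (fun i => X i ω) j) = fun _ => (0 : ℝ) := by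
      ext ω
      have h : {t : ℝ | j ≤ (Finset.univ.filter fun i => X i ω ≤ t).card} = ∅ := by
        ext t
        simp only [mem_ofPred_eq, mem_empty_iff_false, iff_false, not_le]
        exact lt_of_le_of_lt 
          ((Finset.card_le_univ _).trans_eq (Fintype.card_fin N)) hjN
      simp [orderStat, h]
    rw [this]; exact measurable_const

lemma measurable_ivtStatistic {Ω : Type*} [MeasurableSpace Ω] (F : ℝ → ℝ) {N : ℕ}
    {X : Fin N → Ω → ℝ} (hX : ∀ i, Measurable (X i)) (k : ℕ) :
    Measurable fun ω => ivtStatistic F (fun i => X i ω) k := by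
  unfold ivtStatistic
  exact ((measurable_orderStat hX _).sub_const _).div
    ((measurable_orderStat hX _).sub (measurable_orderStat hX _))

/-- Chebyshev's inequality for the number of sample points in a set. -/
lemma measure_countIn_sub_ge_le {Ω : Type*} [MeasurableSpace Ω] {μ : Measure Ω}
    [IsProbabilityMeasure μ] {N : ℕ} {X : Fin N → Ω → ℝ} (hX : ∀ i, Measurable (X i))
    (hind : iIndepFun X μ) {s : Set ℝ} (hs : MeasurableSet s) {q : ℝ}
    (hq : ∀ i, μ.real (X i ⁻¹' s) = q) {δ : ℝ} (hδ : 0 < δ) :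
    μ {ω | δ ≤ |(countIn (fun i => X i ω) s : ℝ) - N * q|} ≤ ENNReal.ofReal (N * q / δ ^ 2) := by
  set I : Fin N → Ω → ℝ := fun i ω => s.indicator (fun _ => (1 : ℝ)) (X i ω) with hI
  have hm : ∀ i, Measurable (I i) := fun i => (measurable_const.indicator hs).comp (hX i)
  have hIind : ∀ i, I i = (X i ⁻¹' s).indicator (fun _ => (1 : ℝ)) := fun i => rfl
  have hL : ∀ i, MemLp (I i) 2 μ := fun i => by
    rw [hIind]; exact (memLp_const (1 : ℝ)).indicator (hX i hs)
  have hint : ∀ i, ∫ ω, I i ω ∂μ = q := fun i => by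
    rw [hIind, integral_indicator_const _ (hX i hs), hq]; simp
  have hsum : (fun ω => (countIn (fun i => X i ω) s : ℝ)) = ∑ i, I i := by
    ext ω; rw [countIn_eq_sum, Finset.sum_apply]
  have hvar : ∀ i, variance (I i) μ ≤ q := fun i => by
    refine (variance_le_expectation_sq (hm i).aestronglyMeasurable).trans (le_of_eq ?_)
    rw [← hint i]
    congr 1
    ext ω
    by_cases h : X i ω ∈ s <;> simp [hI, h]
  have hmean : ∫ ω, (∑ i, I i) ω ∂μ = N * q := by
    simp_rw [Finset.sum_apply]
    rw [integral_finsetSum _ fun i _ => (hL i).integrable (by norm_num)]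
    simp [hint]
  have hLs : MemLp (∑ i, I i) 2 μ := memLp_finsetSum' _ fun i _ => hL i
  have := meas_ge_le_variance_div_sq hLs hδ
  rw [hmean, ← hsum] at this
  refine this.trans (ENNReal.ofReal_le_ofReal ?_)
  gcongr
  rw [hsum, IndepFun.variance_sum (fun i _ => hL i)]
  · calc ∑ i, variance (I i) μ ≤ ∑ i : Fin N, q := Finset.sum_le_sum fun i _ => hvar i
      _ = N * q := by simp
  · intro i _ j _ hij
    exact (hind.indepFun hij).comp (measurable_const.indicator hs) (measurable_const.indicator hs)

/-! ### Central limit theorem for counts of rare events -/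

/-- Second-order expansion at s of the characteristic function of a centred Bernoulli(q) variable.
The error must be small relative to q s²: it is multiplied by N with N q s² = t² fixed, and 5q t² +
t²|s| vanishes as q, s → 0. -/
lemma norm_bernoulli_charFun_sub_le {s q : ℝ} (hs : |s| ≤ 1) (hq : 0 ≤ q) (hq1 : q ≤ 1) :
    ‖Complex.exp (-(s * q * Complex.I)) * (1 + q * (Complex.exp (s * Complex.I) - 1)) - 1
      + q * s ^ 2 / 2‖ ≤ 5 * q ^ 2 * s ^ 2 + q * |s| ^ 3 := by
  set z : ℂ := s * Complex.I with hz
  set w : ℂ := -(s * q * Complex.I) with hw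
  have hzn : ‖z‖ = |s| := by simp [hz]
  have hwn : ‖w‖ = |s| * q := by simp [hw, abs_of_nonneg hq]
  have hsq : |s| * q ≤ 1 := mul_le_one₀ hs hq hq1
  have e1 : ‖Complex.exp w - 1 - w‖ ≤ (|s| * q) ^ 2 := by
    rw [← hwn]; exact Complex.norm_exp_sub_one_sub_id_le (by rw [hwn]; exact hsq)
  have e2 : ‖Complex.exp w - 1‖ ≤ 2 * (|s| * q) := by
    rw [← hwn]; exact Complex.norm_exp_sub_one_le (by rw [hwn]; exact hsq)
  have e3 : ‖Complex.exp z - 1‖ ≤ 2 * |s| := by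
    rw [← hzn]; exact Complex.norm_exp_sub_one_le (by rw [hzn]; exact hs)
  have e4 : ‖Complex.exp z - 1 - z - z ^ 2 / 2‖ ≤ |s| ^ 3 := by
    have := Complex.exp_bound (x := z) (by rw [hzn]; exact hs) (n := 3) (by norm_num)
    simp only [Finset.sum_range_succ, Finset.sum_range_zero] at this
    norm_num [Nat.factorial] at this
    rw [hzn] at this
    have h3 : 0 ≤ |s| ^ 3 := by positivity
    calc _ = ‖Complex.exp z - (1 + z + z ^ 2 / 2)‖ := by congr 1; ring
      _ ≤ _ := this
      _ ≤ _ := by linarith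
  -- Since w = -q z, the linear terms cancel, and q z²/2 cancels against q s²/2 because z² = -s².
  have key : Complex.exp w * (1 + q * (Complex.exp z - 1)) - 1 + q * s ^ 2 / 2 =
      (Complex.exp w - 1 - w) + q * (Complex.exp z - 1 - z - z ^ 2 / 2)
        + (Complex.exp w - 1) * q * (Complex.exp z - 1) := by
    have hz2 : z ^ 2 = -(s : ℂ) ^ 2 := by rw [hz, mul_pow, Complex.I_sq]; ring
    have hwz : w = -(q * z) := by rw [hw, hz]; ring
    rw [hz2]
    linear_combination -hwz
  rw [key]
  have hqn : ‖(q : ℂ)‖ = q := by simp [abs_of_nonneg hq]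
  calc _ ≤ ‖Complex.exp w - 1 - w‖ + ‖(q : ℂ) * (Complex.exp z - 1 - z - z ^ 2 / 2)‖
        + ‖(Complex.exp w - 1) * q * (Complex.exp z - 1)‖ := norm_add₃_le
    _ ≤ (|s| * q) ^ 2 + q * |s| ^ 3 + 2 * (|s| * q) * q * (2 * |s|) := by
        rw [norm_mul, norm_mul, norm_mul, hqn]; gcongr
    _ = 5 * q ^ 2 * |s| ^ 2 + q * |s| ^ 3 := by ring
    _ = _ := by rw [sq_abs]

/-- The central limit theorem for the number of points of an i.i.d. sample of size `N` in a set of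
probability `k N / N`, where `k N → ∞` and `k N / N → 0`. -/
theorem tendstoInDistribution_countIn {Ω : Type*} [MeasurableSpace Ω] {P : Measure Ω}
    [IsProbabilityMeasure P] {X : ℕ → Ω → ℝ} (hX : ∀ i, Measurable (X i)) (hind : iIndepFun X P)
    {s : ℕ → Set ℝ} (hs : ∀ N, MeasurableSet (s N)) {k : ℕ → ℕ} (hk : Tendsto k atTop atTop)
    (hkN : Tendsto (fun N : ℕ => (k N : ℝ) / N) atTop (𝓝 0))
    (hq : ∀ᶠ N in atTop, ∀ i, P.real (X i ⁻¹' s N) = (k N : ℝ) / N) :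
    TendstoInDistribution
      (fun (N : ℕ) ω => ((countIn (fun i : Fin N => X i ω) (s N) : ℝ) - k N) / √(k N : ℝ))
      atTop id (fun _ => P) (gaussianReal 0 1) where
  forall_aemeasurable N :=
    (((measurable_countIn (fun i : Fin N => hX i) (hs N)).sub_const _).div_const _).aemeasurable
  tendsto := by
    refine ProbabilityMeasure.tendsto_iff_tendsto_charFun.2 fun t ↦ ?_
    have hlim : charFun ((gaussianReal 0 1).map id) t = Complex.exp (-(t : ℂ) ^ 2 / 2) := by
      rw [Measure.map_id, charFun_gaussianReal]; simp [neg_div]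
    simp only [ProbabilityMeasure.coe_mk]
    rw [hlim]
    have hkr : Tendsto (fun N => (k N : ℝ)) atTop atTop := tendsto_natCast_atTop_atTop.comp hk
    have hsk : Tendsto (fun N => √(k N : ℝ)) atTop atTop := Real.tendsto_sqrt_atTop.comp hkr
    have hs0 : Tendsto (fun N => t / √(k N : ℝ)) atTop (𝓝 0) := hsk.const_div_atTop t
    -- 1 + g N is the characteristic function at t of one centred indicator divided by √k; the goal
    -- becomes (1 + g N)^N → exp(-t²/2), which follows from N g N → -t²/2.
    set g : ℕ → ℂ := fun N =>
      Complex.exp (-((t / √(k N : ℝ) : ℝ) * ((k N : ℝ) / N : ℝ) * Complex.I)) *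
        (1 + ((k N : ℝ) / N : ℝ) * (Complex.exp ((t / √(k N : ℝ) : ℝ) * Complex.I) - 1)) - 1
      with hg
    have hgl : Tendsto (fun N : ℕ => (N : ℂ) * g N) atTop (𝓝 (-(t : ℂ) ^ 2 / 2)) := by
      rw [tendsto_iff_norm_sub_tendsto_zero]
      have hb : Tendsto (fun N : ℕ => 5 * ((k N : ℝ) / N) * t ^ 2 + t ^ 2 * |t / √(k N : ℝ)|)
          atTop (𝓝 0) := by
        have := ((hkN.const_mul 5).mul_const (t ^ 2)).add (hs0.abs.const_mul (t ^ 2))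
        simpa using this
      refine squeeze_zero' (Eventually.of_forall fun _ => norm_nonneg _) ?_ hb
      filter_upwards [eventually_gt_atTop 0, hk.eventually_gt_atTop 0,
        hkN.eventually_le_const (zero_lt_one), (hs0.abs).eventually_le_const
          (by simp : |(0 : ℝ)| < 1)] with N hN hkp hq1 hs1
      set q : ℝ := (k N : ℝ) / N
      set σ : ℝ := t / √(k N : ℝ)
      have hNr : (0 : ℝ) < N := by exact_mod_cast hN
      have hkp' : (0 : ℝ) < k N := by exact_mod_cast hkp
      have hNq : (N : ℝ) * q * σ ^ 2 = t ^ 2 := by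
        simp only [q, σ]
        rw [div_pow, Real.sq_sqrt hkp'.le]; field_simp
      have hb := norm_bernoulli_charFun_sub_le hs1 (by positivity : 0 ≤ q) hq1
      have hc : (N : ℂ) * g N - -(t : ℂ) ^ 2 / 2 = N * (g N + q * σ ^ 2 / 2) := by
        have : ((N : ℂ) * q * σ ^ 2) = (t : ℂ) ^ 2 := by exact_mod_cast hNq
        linear_combination (-1 / 2) * this
      rw [hc, norm_mul, Complex.norm_natCast]
      calc (N : ℝ) * ‖g N + q * σ ^ 2 / 2‖ ≤ N * (5 * q ^ 2 * σ ^ 2 + q * |σ| ^ 3) := by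
            gcongr
        _ = 5 * q * (N * q * σ ^ 2) + (N * q * |σ| ^ 2) * |σ| := by ring
        _ = _ := by rw [sq_abs, hNq]
    refine (Complex.tendsto_one_add_pow_exp_of_tendsto hgl).congr' ?_
    filter_upwards [eventually_gt_atTop 0, hk.eventually_gt_atTop 0, hq] with N hN hkp hqN
    set q : ℝ := (k N : ℝ) / N with hqdef
    set σ : ℝ := t / √(k N : ℝ) with hσ
    have hNr : (N : ℝ) ≠ 0 := by exact_mod_cast hN.ne'
    have hsum : (fun ω => ((countIn (fun i : Fin N => X i ω) (s N) : ℝ) - k N) / √(k N : ℝ)) =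
        fun ω => ∑ i : Fin N,
          (((s N).indicator (fun _ => (1 : ℝ)) (X i ω) - q) / √(k N : ℝ)) := by
      ext ω
      rw [← Finset.sum_div, Finset.sum_sub_distrib, countIn_eq_sum]
      simp only [Finset.sum_const, Finset.card_univ, Fintype.card_fin, nsmul_eq_mul, hqdef]
      rw [mul_div_cancel₀ _ hNr]
    have hmI : Measurable fun x => ((s N).indicator (fun _ => (1 : ℝ)) x - q) / √(k N : ℝ) :=
      ((measurable_const.indicator (hs N)).sub_const _).div_const _
    have hind' : iIndepFun (fun (i : Fin N) ω =>
        ((s N).indicator (fun _ => (1 : ℝ)) (X i ω) - q) / √(k N : ℝ)) P :=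
      (hind.precomp (g := fun i : Fin N => (i : ℕ)) Fin.val_injective).comp
        (fun _ x => ((s N).indicator (fun _ => (1 : ℝ)) x - q) / √(k N : ℝ)) (fun _ => hmI)
    have hmX : ∀ i : Fin N, AEMeasurable
        (fun ω => ((s N).indicator (fun _ => (1 : ℝ)) (X i ω) - q) / √(k N : ℝ)) P :=
      fun i => (hmI.comp (hX i)).aemeasurable
    rw [hsum, iIndepFun.charFun_map_fun_sum_eq_prod hmX hind', Finset.prod_apply]
    have hone : ∀ i : Fin N, charFun (P.map fun ω =>
        ((s N).indicator (fun _ => (1 : ℝ)) (X i ω) - q) / √(k N : ℝ)) t = 1 + g N := by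
      intro i
      rw [charFun_apply_real, integral_map (hmX i) (by fun_prop)]
      have hpt : ∀ ω, Complex.exp (t * ((((s N).indicator (fun _ => (1 : ℝ)) (X i ω) - q)
          / √(k N : ℝ) : ℝ) : ℂ) * Complex.I) =
          Complex.exp (-(σ * q * Complex.I)) +
          (X i ⁻¹' s N).indicator (fun _ => Complex.exp (-(σ * q * Complex.I)) *
            (Complex.exp (σ * Complex.I) - 1)) ω := by
        intro ω
        by_cases h : X i ω ∈ s N
        · have h' : ω ∈ X i ⁻¹' s N := h
          rw [indicator_of_mem h, indicator_of_mem h', mul_sub, mul_one, add_sub_cancel,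
            ← Complex.exp_add]
          congr 1
          rw [hσ]; push_cast; ring
        · have h' : ω ∉ X i ⁻¹' s N := h
          rw [indicator_of_notMem h, indicator_of_notMem h', add_zero]
          congr 1
          rw [hσ]; push_cast; ring
      simp_rw [hpt]
      rw [integral_add (integrable_const _)
        ((integrable_const _).indicator (hX i (hs N))),
        integral_indicator_const _ (hX i (hs N)), hqN i]
      simp only [integral_const, probReal_univ, one_smul, hg, Complex.real_smul]
      rw [← hqdef, ← hσ]
      ring
    simp_rw [hone]
    simp

/-! ### From counts to order statistics and self-normalised ratios -/

/-- Bahadur representation: if the exceedance counts over the levels `t y` are asymptotically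
affine in `y`, so are the rescaled order statistics. -/
lemma tendsto_measure_orderStat_sub {Ω ι : Type*} [MeasurableSpace Ω] {P : Measure Ω}
    {l : Filter ι} {n κ m : ι → ℕ} {X : (i : ι) → Fin (n i) → Ω → ℝ} {t : ℝ → ι → ℝ} {t₀ c : ι → ℝ}
    {B : ι → Ω → ℝ} {x : ℝ} (hc : ∀ᶠ i in l, 0 < c i) (hκ : ∀ᶠ i in l, 0 < κ i)
    (hm : Tendsto (fun i => (m i : ℝ) / √(κ i : ℝ)) l (𝓝 x)) (hn : ∀ᶠ i in l, κ i + m i < n i)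
    (ht : ∀ y, Tendsto (fun i => (t y i - t₀ i) * (√(κ i : ℝ) / c i)) l (𝓝 y))
    (hcount : ∀ y δ : ℝ, 0 < δ → Tendsto (fun i => P {ω | δ ≤
      |((countIn (fun j => X i j ω) (Ioi (t y i)) : ℝ) - κ i) / √(κ i : ℝ) + y - B i ω|}) l (𝓝 0))
    (htight : ∀ r : ENNReal, 0 < r → ∃ M : ℝ, ∀ᶠ i in l, P {ω | M ≤ |B i ω|} ≤ r)
    {δ : ℝ} (hδ : 0 < δ) :
    Tendsto (fun i => P {ω | δ ≤ |(orderStat (fun j => X i j ω) (n i - κ i - m i) - t₀ i) *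
      (√(κ i : ℝ) / c i) - (B i ω - x)|}) l (𝓝 0) := by
  rw [ENNReal.tendsto_nhds_zero]
  intro r hr
  -- Four errors of size η occur: the count, m/√κ against x, the rounding to the grid ηℤ, and the
  -- level t. Their sum 4η stays below δ.
  set η : ℝ := δ / 5 with hη
  have hη0 : 0 < η := by positivity
  obtain ⟨M, hM⟩ := htight (r / 2) (ENNReal.half_pos hr.ne')
  -- Tightness confines B to [-M, M], so only the grid points jη with |j| ≤ J are ever needed and a
  -- finite union bound controls the counts.
  obtain ⟨J, hJ⟩ := exists_nat_gt ((M + |x| + 4 * η) / η)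
  rw [div_lt_iff₀ hη0] at hJ
  set S : Finset ℤ := Finset.Icc (-(J : ℤ)) J
  have hbad : Tendsto (fun i => ∑ j ∈ S, P {ω | η ≤
      |((countIn (fun j => X i j ω) (Ioi (t (j * η) i)) : ℝ) - κ i) / √(κ i : ℝ) + j * η
        - B i ω|}) l (𝓝 0) := by
    have := tendsto_finsetSum S fun j _ => hcount ((j : ℝ) * η) η hη0
    simpa using this
  have hlev : ∀ᶠ i in l, ∀ j ∈ S,
      |(t ((j : ℝ) * η) i - t₀ i) * (√(κ i : ℝ) / c i) - j * η| < η := by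
    rw [Finset.eventually_all]
    intro j _
    have := (ht ((j : ℝ) * η)).eventually (Metric.ball_mem_nhds _ hη0)
    simpa [Real.dist_eq] using this
  have hmx : ∀ᶠ i in l, |(m i : ℝ) / √(κ i : ℝ) - x| < η := by
    have := hm.eventually (Metric.ball_mem_nhds _ hη0)
    simpa [Real.dist_eq] using this
  filter_upwards [hc, hκ, hn, hM, hlev, hmx,
    (ENNReal.tendsto_nhds_zero.1 hbad) (r / 2) (ENNReal.half_pos hr.ne')]
    with i hci hκi hni hMi hlevi hmi hbadi
  have hsκ : 0 < √(κ i : ℝ) := Real.sqrt_pos.2 (by exact_mod_cast hκi)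
  have hK : 0 < √(κ i : ℝ) / c i := by positivity
  refine (measure_mono (t := {ω | M ≤ |B i ω|} ∪ ⋃ j ∈ S, {ω | η ≤
      |((countIn (fun j => X i j ω) (Ioi (t (j * η) i)) : ℝ) - κ i) / √(κ i : ℝ) + j * η
        - B i ω|}) ?_).trans ?_
  · intro ω hω
    by_contra hcon
    simp only [mem_union, mem_iUnion, mem_ofPred_eq, not_or, not_exists, not_le] at hcon hω
    obtain ⟨hB, hgood⟩ := hcon
    have hsub : n i - κ i - m i = n i - (κ i + m i) := by omega
    rw [hsub] at hω
    have hord : ∀ s : ℝ, orderStat (fun j => X i j ω) (n i - (κ i + m i)) ≤ s ↔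
        ((countIn (fun j => X i j ω) (Ioi s) : ℝ) - κ i) / √(κ i : ℝ) ≤ m i / √(κ i : ℝ) := by
      intro s
      rw [orderStat_sub_le_iff _ hni, div_le_div_iff_of_pos_right hsκ, sub_le_iff_le_add',
        ← Nat.cast_add, Nat.cast_le]
    rw [abs_lt] at hmi hB
    have hxa := neg_abs_le x
    have hxb := le_abs_self x
    have hmem : ∀ j : ℤ, |(j : ℝ) * η| ≤ M + |x| + 3 * η → j ∈ S := by
      intro j hj
      have h1 : |(j : ℝ)| * η < J * η := by
        rw [abs_mul, abs_of_pos hη0] at hj; linarith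
      have h2 : |(j : ℝ)| < J := lt_of_mul_lt_mul_right h1 hη0.le
      rw [abs_lt] at h2
      simp only [S, Finset.mem_Icc]
      constructor
      · exact_mod_cast h2.1.le
      · exact_mod_cast h2.2.le
    have hup : (orderStat (fun j => X i j ω) (n i - (κ i + m i)) - t₀ i) * (√(κ i : ℝ) / c i)
        ≤ B i ω - x + 4 * η := by
      set j : ℤ := ⌈(B i ω - x + 2 * η) / η⌉
      have h1 : B i ω - x + 2 * η ≤ j * η := (div_le_iff₀ hη0).1 (Int.le_ceil _)
      have h2 : (j : ℝ) * η < B i ω - x + 3 * η := by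
        have := mul_lt_mul_of_pos_right (Int.ceil_lt_add_one ((B i ω - x + 2 * η) / η)) hη0
        rw [add_mul, div_mul_cancel₀ _ hη0.ne'] at this
        linarith
      have hj : j ∈ S := hmem j (abs_le.2 ⟨by linarith, by linarith⟩)
      have h3 := abs_lt.1 (hgood j hj)
      have h4 := abs_lt.1 (hlevi j hj)
      have h5 := (hord (t (j * η) i)).2 (by linarith [h3.2, hmi.1])
      have h6 := mul_le_mul_of_nonneg_right (sub_le_sub_right h5 (t₀ i)) hK.le
      linarith [h4.2]
    have hlow : B i ω - x - 4 * η ≤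
        (orderStat (fun j => X i j ω) (n i - (κ i + m i)) - t₀ i) * (√(κ i : ℝ) / c i) := by
      set j : ℤ := ⌊(B i ω - x - 2 * η) / η⌋
      have h1 : j * η ≤ B i ω - x - 2 * η := (le_div_iff₀ hη0).1 (Int.floor_le _)
      have h2 : B i ω - x - 3 * η < (j : ℝ) * η := by
        have := mul_lt_mul_of_pos_right (Int.sub_one_lt_floor ((B i ω - x - 2 * η) / η)) hη0
        rw [sub_mul, div_mul_cancel₀ _ hη0.ne'] at this
        linarith
      have hj : j ∈ S := hmem j (abs_le.2 ⟨by linarith, by linarith⟩)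
      have h3 := abs_lt.1 (hgood j hj)
      have h4 := abs_lt.1 (hlevi j hj)
      have h5 : t (j * η) i < orderStat (fun j => X i j ω) (n i - (κ i + m i)) := by
        rw [← not_le, hord, not_le]
        linarith [h3.1, hmi.2]
      have h6 := mul_le_mul_of_nonneg_right (sub_le_sub_right h5.le (t₀ i)) hK.le
      linarith [h4.1]
    have : |(orderStat (fun j => X i j ω) (n i - (κ i + m i)) - t₀ i) * (√(κ i : ℝ) / c i)
        - (B i ω - x)| ≤ 4 * η := abs_le.2 ⟨by linarith, by linarith⟩
    linarith
  · calc _ ≤ P {ω | M ≤ |B i ω|} + P (⋃ j ∈ S, {ω | η ≤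
      |((countIn (fun j => X i j ω) (Ioi (t (j * η) i)) : ℝ) - κ i) / √(κ i : ℝ) + j * η
        - B i ω|}) := measure_union_le _ _
      _ ≤ r / 2 + r / 2 := add_le_add hMi ((measure_biUnion_finset_le _ _).trans hbadi)
      _ = r := ENNReal.add_halves r

/-- A ratio `W₀ / (W₀ - W₁)` is asymptotically equivalent to the tight sequence `B` if `W₀ - B` and
`W₁ - (B - 1)` tend to zero in probability. -/
lemma tendsto_measure_div_sub {Ω ι : Type*} [MeasurableSpace Ω] {P : Measure Ω} {l : Filter ι}
    {W₀ W₁ B : ι → Ω → ℝ}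
    (h₀ : ∀ δ : ℝ, 0 < δ → Tendsto (fun i => P {ω | δ ≤ |W₀ i ω - B i ω|}) l (𝓝 0))
    (h₁ : ∀ δ : ℝ, 0 < δ → Tendsto (fun i => P {ω | δ ≤ |W₁ i ω - (B i ω - 1)|}) l (𝓝 0))
    (htight : ∀ r : ENNReal, 0 < r → ∃ M : ℝ, ∀ᶠ i in l, P {ω | M ≤ |B i ω|} ≤ r)
    {δ : ℝ} (hδ : 0 < δ) :
    Tendsto (fun i => P {ω | δ ≤ |W₀ i ω / (W₀ i ω - W₁ i ω) - B i ω|}) l (𝓝 0) := by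
  rw [ENNReal.tendsto_nhds_zero]
  intro r hr
  obtain ⟨M, hM⟩ := htight (r / 2) (ENNReal.half_pos hr.ne')
  -- The denominator is within 2η of 1, hence at least 1/2, and the ratio then differs from B by at
  -- most 2η(1 + 2|M|) ≤ δ/2.
  set η : ℝ := min (1 / 8) (δ / (4 * (1 + 2 * |M|))) with hη
  have hη0 : 0 < η := lt_min (by norm_num) (by positivity)
  have hη1 : η ≤ 1 / 8 := min_le_left _ _
  have hη2 : η * (4 * (1 + 2 * |M|)) ≤ δ := by
    rw [← le_div_iff₀ (by positivity)]; exact min_le_right _ _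
  have hsum := (h₀ η hη0).add (h₁ η hη0)
  rw [add_zero] at hsum
  filter_upwards [hM, (ENNReal.tendsto_nhds_zero.1 hsum) (r / 2) (ENNReal.half_pos hr.ne')]
    with i hMi hi
  refine (measure_mono (t := {ω | M ≤ |B i ω|} ∪
    ({ω | η ≤ |W₀ i ω - B i ω|} ∪ {ω | η ≤ |W₁ i ω - (B i ω - 1)|})) ?_).trans ?_
  · intro ω hω
    by_contra hcon
    simp only [mem_union, mem_ofPred_eq, not_or, not_le] at hcon hω
    obtain ⟨hB, hW0, hW1⟩ := hcon
    set D := W₀ i ω - W₁ i ω with hD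
    have hD1 : |D - 1| ≤ 2 * η := by
      rw [abs_lt] at hW0 hW1
      rw [abs_le]; constructor <;> linarith [hW0.1, hW0.2, hW1.1, hW1.2]
    have hDpos : 1 / 2 ≤ D := by linarith [(abs_le.1 hD1).1]
    have hBM : |B i ω| ≤ |M| := hB.le.trans (le_abs_self M)
    have heq : W₀ i ω / D - B i ω = ((W₀ i ω - B i ω) - B i ω * (D - 1)) / D := by
      field_simp; ring
    have hnum : |(W₀ i ω - B i ω) - B i ω * (D - 1)| ≤ η + |M| * (2 * η) := by
      refine (abs_sub _ _).trans ?_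
      rw [abs_mul]
      gcongr
    have : |W₀ i ω / D - B i ω| ≤ (η + |M| * (2 * η)) / (1 / 2) := by
      rw [heq, abs_div, abs_of_pos (by linarith : 0 < D)]
      gcongr
    have h2 : (η + |M| * (2 * η)) / (1 / 2) = η * (4 * (1 + 2 * |M|)) / 2 := by ring
    linarith
  · calc _ ≤ P {ω | M ≤ |B i ω|} +
          (P {ω | η ≤ |W₀ i ω - B i ω|} + P {ω | η ≤ |W₁ i ω - (B i ω - 1)|}) :=
        (measure_union_le _ _).trans (by gcongr; exact measure_union_le _ _)
      _ ≤ r / 2 + r / 2 := add_le_add hMi hi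
      _ = r := ENNReal.add_halves r

lemma tendsto_floor_sqrt_div_sqrt {ι : Type*} {l : Filter ι} {κ : ι → ℕ}
    (hκ : Tendsto κ l atTop) :
    Tendsto (fun i => (⌊√(κ i : ℝ)⌋₊ : ℝ) / √(κ i : ℝ)) l (𝓝 1) :=
  (tendsto_nat_floor_div_atTop (R := ℝ)).comp
    (Real.tendsto_sqrt_atTop.comp (tendsto_natCast_atTop_atTop.comp hκ))

lemma eventually_add_floor_sqrt_lt {ι : Type*} {l : Filter ι} {n κ : ι → ℕ}
    (hn : Tendsto n l atTop) (hκ : Tendsto κ l atTop)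
    (hκn : Tendsto (fun i => (κ i : ℝ) / n i) l (𝓝 0)) :
    ∀ᶠ i in l, κ i + ⌊√(κ i : ℝ)⌋₊ < n i := by
  filter_upwards [hκ.eventually_gt_atTop 0,
    hκn.eventually_lt_const (by norm_num : (0 : ℝ) < 1 / 2), hn.eventually_gt_atTop 0]
    with i h1 h2 h3
  have hκ1 : (1 : ℝ) ≤ κ i := by exact_mod_cast h1
  have hle : √(κ i : ℝ) ≤ κ i := Real.sqrt_le_self_iff.2 (Or.inr hκ1)
  have hfl := Nat.floor_le (Real.sqrt_nonneg (κ i : ℝ))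
  rw [div_lt_iff₀ (by exact_mod_cast h3)] at h2
  have : ((κ i + ⌊√(κ i : ℝ)⌋₊ : ℕ) : ℝ) < n i := by push_cast; linarith
  exact_mod_cast this

/-- If the exceedance counts of the samples `X i` over the levels `t y` are asymptotically affine
in `y`, the self-normalised statistic is asymptotically normal. -/
theorem tendstoInDistribution_ivtStatistic {Ω ι : Type*} [MeasurableSpace Ω] {P : Measure Ω}
    [IsProbabilityMeasure P] {l : Filter ι} [l.IsCountablyGenerated] {F : ℝ → ℝ}
    {n κ : ι → ℕ} {X : (i : ι) → Fin (n i) → Ω → ℝ} (hX : ∀ i j, Measurable (X i j))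
    {t : ℝ → ι → ℝ} {c : ι → ℝ} {B : ι → Ω → ℝ} (hc : ∀ᶠ i in l, 0 < c i)
    (hn : Tendsto n l atTop)
    (hκ : Tendsto κ l atTop) (hκn : Tendsto (fun i => (κ i : ℝ) / n i) l (𝓝 0))
    (ht : ∀ y, Tendsto (fun i => (t y i - (quantile F (1 - (κ i : ℝ) / n i)).toReal) *
      (√(κ i : ℝ) / c i)) l (𝓝 y))
    (hcount : ∀ y δ : ℝ, 0 < δ → Tendsto (fun i => P {ω | δ ≤
      |((countIn (fun j => X i j ω) (Ioi (t y i)) : ℝ) - κ i) / √(κ i : ℝ) + y - B i ω|}) l (𝓝 0))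
    (htight : ∀ r : ENNReal, 0 < r → ∃ M : ℝ, ∀ᶠ i in l, P {ω | M ≤ |B i ω|} ≤ r)
    (hB : TendstoInDistribution B l id (fun _ => P) (gaussianReal 0 1)) :
    TendstoInDistribution (fun i ω => ivtStatistic F (fun j => X i j ω) (κ i)) l id (fun _ => P)
      (gaussianReal 0 1) := by
  refine tendstoInDistribution_of_tendstoInMeasure_sub _ _ hB ?_
    fun i => (measurable_ivtStatistic F (hX i) (κ i)).aemeasurable
  rw [tendstoInMeasure_iff_norm]
  intro δ hδ
  have hκ0 := hκ.eventually_gt_atTop 0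
  have hlt := eventually_add_floor_sqrt_lt hn hκ hκn
  -- Orders κ and κ + ⌊√κ⌋ correspond to x = 0 and x = 1, so the rescaled spacing tends to 1. The
  -- factor √κ / c is common to numerator and denominator and drops out at the end.
  have h₀ := fun δ (hδ : 0 < δ) => tendsto_measure_orderStat_sub (m := fun _ => 0) (x := 0) hc hκ0
    (by simpa using tendsto_const_nhds) (hlt.mono fun i hi => by omega) ht hcount htight hδ
  have h₁ := fun δ (hδ : 0 < δ) => tendsto_measure_orderStat_sub hc hκ0
    (tendsto_floor_sqrt_div_sqrt hκ) hlt ht hcount htight hδ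
  simp only [Nat.sub_zero, sub_zero] at h₀
  refine (tendsto_measure_div_sub h₀ h₁ htight hδ).congr' ?_
  filter_upwards [hc, hκ0] with i hci hκi
  have hK : √(κ i : ℝ) / c i ≠ 0 := by
    have : 0 < √(κ i : ℝ) := Real.sqrt_pos.2 (by exact_mod_cast hκi)
    positivity
  congr 1
  ext ω
  simp only [mem_ofPred_eq, Pi.sub_apply, Pi.zero_apply, sub_zero, Real.norm_eq_abs, ivtStatistic]
  rw [← sub_mul, mul_div_mul_right _ _ hK, sub_sub_sub_cancel_right]

/-! ### Distribution functions and the tail quantile function -/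

/-- The defining properties of a distribution function on the real line. -/
structure IsDistribFun (F : ℝ → ℝ) : Prop where
  mono : Monotone F
  rightCont : ∀ x, ContinuousWithinAt F (Ici x) x
  tendsto_atBot : Tendsto F atBot (𝓝 0)
  tendsto_atTop : Tendsto F atTop (𝓝 1)

lemma isDistribFun_cdf (μ : Measure ℝ) : IsDistribFun (cdf μ) :=
  ⟨monotone_cdf μ, (cdf μ).right_continuous, tendsto_cdf_atBot μ, tendsto_cdf_atTop μ⟩

lemma quantile_le {F : ℝ → ℝ} {p x : ℝ} (h0 : 0 < F x) (h : p ≤ F x) : quantile F p ≤ x :=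
  sInf_le ⟨x, ⟨h0, h⟩, rfl⟩

lemma quantile_mono (F : ℝ → ℝ) {p p' : ℝ} (h : p ≤ p') : quantile F p ≤ quantile F p' :=
  sInf_le_sInf (image_mono fun _ hx => ⟨hx.1, h.trans hx.2⟩)

lemma apply_le_of_lt_quantile {F : ℝ → ℝ} {p x : ℝ} (hp : 0 ≤ p) (h : (x : EReal) < quantile F p) :
    F x ≤ p := by
  by_contra hcon
  push Not at hcon
  exact absurd (quantile_le (hp.trans_lt hcon) hcon.le) (not_le.2 h)

namespace IsDistribFun

variable {F : ℝ → ℝ}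

lemma le_apply_of_quantile_le (hF : IsDistribFun F) {p x : ℝ} (h : quantile F p ≤ x) :
    p ≤ F x := by
  have ht : Tendsto F (𝓝[>] x) (𝓝 (F x)) :=
    (hF.rightCont x).tendsto.mono_left (nhdsWithin_mono _ Ioi_subset_Ici_self)
  refine ge_of_tendsto ht ?_
  filter_upwards [self_mem_nhdsWithin] with y hy
  have : quantile F p < (y : EReal) := h.trans_lt (EReal.coe_lt_coe_iff.2 hy)
  obtain ⟨_, ⟨z, hz, rfl⟩, hzy⟩ := sInf_lt_iff.1 this
  exact hz.2.trans (hF.mono (EReal.coe_lt_coe_iff.1 hzy).le)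

lemma quantile_ne_top (hF : IsDistribFun F) {p : ℝ} (hp : p < 1) : quantile F p ≠ ⊤ := by
  obtain ⟨x, hx⟩ := (hF.tendsto_atTop.eventually_const_lt
    (max_lt zero_lt_one hp : max 0 p < 1)).exists
  exact ((quantile_le ((le_max_left _ _).trans_lt hx)
    ((le_max_right _ _).trans hx.le)).trans_lt (EReal.coe_lt_top x)).ne

lemma quantile_ne_bot (hF : IsDistribFun F) {p : ℝ} (hp : 0 < p) : quantile F p ≠ ⊥ := by
  obtain ⟨x, hx⟩ := (hF.tendsto_atBot.eventually_lt_const hp).exists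
  intro h
  exact absurd (hF.le_apply_of_quantile_le (h.le.trans bot_le : quantile F p ≤ (x : EReal)))
    (not_le.2 hx)

lemma coe_toReal_quantile (hF : IsDistribFun F) {p : ℝ} (hp : 0 < p) (hp1 : p < 1) :
    ((quantile F p).toReal : EReal) = quantile F p :=
  EReal.coe_toReal (hF.quantile_ne_top hp1) (hF.quantile_ne_bot hp)

lemma coe_tailQuantile (hF : IsDistribFun F) {x : ℝ} (hx : 1 < x) :
    (tailQuantile F x : EReal) = quantile F (1 - 1 / x) := by
  have h0 : 0 < 1 / x := by positivity
  have h1 : 1 / x < 1 := by rw [div_lt_one (by linarith)]; exact hx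
  exact hF.coe_toReal_quantile (by linarith) (by linarith)

/-- Right continuity gives F(U(x)) ≥ 1 - 1/x. The reverse inequality needs left continuity: strictly
below U(x) the values of F are at most 1 - 1/x. -/
lemma apply_tailQuantile (hF : IsDistribFun F) (hc : Continuous F) {x : ℝ} (hx : 1 < x) :
    F (tailQuantile F x) = 1 - 1 / x := by
  have h1 : 1 / x ≤ 1 := by rw [div_le_one (by linarith)]; exact hx.le
  refine le_antisymm ?_ (hF.le_apply_of_quantile_le (hF.coe_tailQuantile hx).ge)
  have ht : Tendsto F (𝓝[<] (tailQuantile F x)) (𝓝 (F (tailQuantile F x))) :=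
    hc.continuousAt.tendsto.mono_left nhdsWithin_le_nhds
  refine le_of_tendsto ht ?_
  filter_upwards [self_mem_nhdsWithin] with y hy
  refine apply_le_of_lt_quantile (by linarith) ?_
  rw [← hF.coe_tailQuantile hx]
  exact EReal.coe_lt_coe_iff.2 hy

lemma tailQuantile_mono (hF : IsDistribFun F) {x y : ℝ} (hx : 1 < x) (hxy : x ≤ y) :
    tailQuantile F x ≤ tailQuantile F y := by
  rw [← EReal.coe_le_coe_iff, hF.coe_tailQuantile hx, hF.coe_tailQuantile (hx.trans_le hxy)]
  exact quantile_mono F (by gcongr)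

lemma tailQuantile_le_iff (hF : IsDistribFun F) (hc : Continuous F) {x y : ℝ} (hx : 1 < x) :
    tailQuantile F x ≤ y ↔ 1 - 1 / x ≤ F y := by
  have h1 : 1 / x < 1 := by rw [div_lt_one (by linarith)]; exact hx
  constructor
  · intro h
    rw [← hF.apply_tailQuantile hc hx]
    exact hF.mono h
  · intro h
    rw [← EReal.coe_le_coe_iff, hF.coe_tailQuantile hx]
    exact quantile_le (by linarith) h

/-- Transports properties holding near the right endpoint to all large x. U(x) stays strictly below
the endpoint because F(U(x)) < 1, and passes every b below it because F(b) < 1. -/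
lemma tendsto_tailQuantile (hF : IsDistribFun F) (hc : Continuous F) :
    Tendsto (tailQuantile F) atTop (leftNhdsEndpoint F) := by
  have hlt : ∀ᶠ x in atTop, (tailQuantile F x : EReal) < rightEndpoint F := by
    filter_upwards [eventually_gt_atTop 1] with x hx
    by_contra hcon
    have := hF.le_apply_of_quantile_le (not_lt.1 hcon)
    rw [hF.apply_tailQuantile hc hx] at this
    have : 0 < 1 / x := by positivity
    linarith
  rw [leftNhdsEndpoint, tendsto_comap_iff, tendsto_nhdsWithin_iff]
  refine ⟨tendsto_order.2 ⟨fun a ha => ?_, fun b hb => hlt.mono fun x hx => hx.trans hb⟩, hlt⟩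
  obtain ⟨b, hab, hb⟩ := EReal.lt_iff_exists_real_btwn.1 ha
  have hFb : F b < 1 := by
    by_contra hcon
    exact absurd (quantile_le (zero_lt_one.trans_le (not_lt.1 hcon)) (not_lt.1 hcon))
      (not_le.2 hb)
  have hlim : Tendsto (fun x : ℝ => 1 - 1 / x) atTop (𝓝 1) := by
    simpa using tendsto_inv_atTop_zero.const_sub (1 : ℝ)
  filter_upwards [eventually_gt_atTop 1, hlim.eventually_const_lt hFb] with x hx h
  refine hab.trans (EReal.coe_lt_coe_iff.2 ?_)
  rw [← not_le, hF.tailQuantile_le_iff hc hx, not_le]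
  exact h

/-- Inverse function rule for 1/(1 - F), of which U is a right inverse. The value is written so that
x U'(x) = ((1 - F)/f)(U(x)). -/
lemma hasDerivAt_tailQuantile (hF : IsDistribFun F) (hc : Continuous F) {x : ℝ} (hx : 1 < x)
    (hd : DifferentiableAt ℝ F (tailQuantile F x)) (hpos : 0 < deriv F (tailQuantile F x)) :
    HasDerivAt (tailQuantile F)
      ((1 - F (tailQuantile F x)) / deriv F (tailQuantile F x) / x) x := by
  have hx0 : 0 < x := by linarith
  have hFx := hF.apply_tailQuantile hc hx
  have hlim : ContinuousAt (fun y : ℝ => 1 - 1 / y) x := by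
    simp only [one_div]
    exact continuousAt_const.sub (continuousAt_inv₀ hx0.ne')
  have hcont : ContinuousAt (tailQuantile F) x := by
    refine tendsto_order.2 ⟨fun b hb => ?_, fun b hb => ?_⟩
    · rw [← not_le, hF.tailQuantile_le_iff hc hx, not_le] at hb
      filter_upwards [lt_mem_nhds hx, hlim.tendsto.eventually_const_lt hb] with y hy h
      rw [← not_le, hF.tailQuantile_le_iff hc hy, not_le]
      exact h
    · obtain ⟨b', hb'1, hb'2⟩ := exists_between hb
      -- F need not be strictly increasing everywhere, but the positive derivative at U(x) excludes
      -- a flat piece starting there, that is, a jump of U at x.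
      have hlt : F (tailQuantile F x) < F b' := by
        have hs : Tendsto (slope F (tailQuantile F x)) (𝓝[≠] (tailQuantile F x))
            (𝓝 (deriv F (tailQuantile F x))) := hasDerivAt_iff_tendsto_slope.1 hd.hasDerivAt
        have h1 := (hs.mono_left (nhdsGT_le_nhdsNE _)).eventually_const_lt hpos
        obtain ⟨z, hz1, hz2⟩ := (h1.and (Ioo_mem_nhdsGT hb'1)).exists
        rw [slope_def_field] at hz1
        have hz3 : 0 < z - tailQuantile F x := by linarith [hz2.1]
        have := (div_pos_iff_of_pos_right hz3).1 hz1
        exact (by linarith : F (tailQuantile F x) < F z).trans_le (hF.mono hz2.2.le)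
      rw [hFx] at hlt
      filter_upwards [lt_mem_nhds hx, hlim.tendsto.eventually_lt_const hlt] with y hy h
      exact ((hF.tailQuantile_le_iff hc hy).2 h.le).trans_lt hb'2
  have h1F : 1 - F (tailQuantile F x) = x⁻¹ := by rw [hFx]; simp
  have hf : HasDerivAt (fun y => (1 - F y)⁻¹)
      (-(-deriv F (tailQuantile F x)) / (1 - F (tailQuantile F x)) ^ 2) (tailQuantile F x) :=
    (hd.hasDerivAt.const_sub 1).fun_inv (by rw [h1F]; positivity)
  rw [h1F] at hf ⊢
  have := HasDerivAt.of_local_left_inverse hcont hf (by rw [neg_neg]; positivity) (by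
    filter_upwards [lt_mem_nhds hx] with y hy
    rw [hF.apply_tailQuantile hc hy]; simp)
  refine this.congr_deriv ?_
  have hd0 := hpos.ne'
  have hx0' := hx0.ne'
  generalize deriv F (tailQuantile F x) = d at hd0
  field_simp

end IsDistribFun

/-! ### Consequences of the von Mises condition -/

/-- Under the von Mises condition the logarithm of the scale `x * U'(x)` of the tail quantile
function `U` is eventually Lipschitz in `log x`. -/
theorem VonMises.exists_scale_lipschitz {F : ℝ → ℝ} {γ : ℝ} (h : VonMises F γ)
    (hF : IsDistribFun F) :
    ∃ C : ℝ, 0 ≤ C ∧ ∃ x₀ : ℝ, 1 < x₀ ∧ (∀ x, x₀ ≤ x → 0 < x * deriv (tailQuantile F) x) ∧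
      (∀ x, x₀ ≤ x → DifferentiableAt ℝ (tailQuantile F) x) ∧
      ∀ x y, x₀ ≤ x → x₀ ≤ y → |Real.log (x * deriv (tailQuantile F) x) -
        Real.log (y * deriv (tailQuantile F) y)| ≤ C * |Real.log x - Real.log y| := by
  set g : ℝ → ℝ := fun t => (1 - F t) / deriv F t with hg
  have hev : ∀ᶠ t in leftNhdsEndpoint F, DifferentiableAt ℝ F t ∧ DifferentiableAt ℝ (deriv F) t ∧
      0 < deriv F t ∧ |deriv g t| < |γ| + 1 := by
    filter_upwards [h.differentiable, h.differentiable_density, h.density_pos,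
      h.tendsto.abs.eventually_lt_const (lt_add_one |γ|)] with t h1 h2 h3 h4
    exact ⟨h1, h2, h3, h4⟩
  obtain ⟨x₁, hx₁⟩ := eventually_atTop.1 ((hF.tendsto_tailQuantile h.continuous).eventually hev)
  have hgood : ∀ x, max x₁ 2 ≤ x → 1 < x ∧
      HasDerivAt (tailQuantile F) (g (tailQuantile F x) / x) x ∧ 0 < g (tailQuantile F x) ∧
      HasDerivAt g (deriv g (tailQuantile F x)) (tailQuantile F x) ∧
      |deriv g (tailQuantile F x)| ≤ |γ| + 1 := by
    intro x hx
    have hx1 : 1 < x := by linarith [(le_max_right x₁ 2).trans hx]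
    obtain ⟨a1, a2, a3, a4⟩ := hx₁ x ((le_max_left _ _).trans hx)
    refine ⟨hx1, hF.hasDerivAt_tailQuantile h.continuous hx1 a1 a3, ?_, ?_, a4.le⟩
    · refine div_pos ?_ a3
      rw [hF.apply_tailQuantile h.continuous hx1]
      have : 0 < 1 / x := by positivity
      linarith
    · exact (((differentiableAt_const _).sub a1).div a2 a3.ne').hasDerivAt
  have hscale : ∀ x, max x₁ 2 ≤ x → x * deriv (tailQuantile F) x = g (tailQuantile F x) := by
    intro x hx
    obtain ⟨b1, b2, -⟩ := hgood x hx
    rw [b2.deriv, mul_div_cancel₀ _ (by linarith)]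
  refine ⟨|γ| + 1, by positivity, max x₁ 2, by linarith [le_max_right x₁ 2], fun x hx => ?_,
    fun x hx => (hgood x hx).2.1.differentiableAt, fun x y hx hy => ?_⟩
  · rw [hscale x hx]; exact (hgood x hx).2.2.1
  · have hx₀ : 0 < max x₁ 2 := by linarith [le_max_right x₁ 2]
    rw [hscale x hx, hscale y hy]
    -- The chain rule gives g'(U) U'(e^τ) e^τ / g(U) at e^τ, and e^τ U'(e^τ) = g(U(e^τ)) cancels,
    -- leaving g'(U(e^τ)), bounded by |γ| + 1.
    have hder : ∀ τ ∈ Ici (Real.log (max x₁ 2)),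
        HasDerivWithinAt (fun τ => Real.log (g (tailQuantile F (Real.exp τ))))
          (deriv g (tailQuantile F (Real.exp τ))) (Ici (Real.log (max x₁ 2))) τ := by
      intro τ hτ
      have hτ' : max x₁ 2 ≤ Real.exp τ := (Real.log_le_iff_le_exp hx₀).1 hτ
      obtain ⟨b1, b2, b3, b4, -⟩ := hgood _ hτ'
      have := ((b4.comp (Real.exp τ) b2).comp τ (Real.hasDerivAt_exp τ)).log b3.ne'
      refine (this.congr_deriv ?_).hasDerivWithinAt
      simp only [Function.comp]
      have := Real.exp_pos τ
      field_simp
    have hb := (convex_Ici (Real.log (max x₁ 2))).norm_image_sub_le_of_norm_hasDerivWithin_le hder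
      (C := |γ| + 1) (fun τ hτ => (hgood _ ((Real.log_le_iff_le_exp hx₀).1 hτ)).2.2.2.2)
      (x := Real.log y) (y := Real.log x)
      (Real.log_le_log hx₀ hy) (Real.log_le_log hx₀ hx)
    simpa only [Real.exp_log (hx₀.trans_le hx), Real.exp_log (hx₀.trans_le hy),
      Real.norm_eq_abs] using hb

/-- Under the von Mises condition, increments of the tail quantile function `U` near `a` are
comparable with increments of `a * U'(a) * log`. -/
theorem VonMises.exists_increment_bounds {F : ℝ → ℝ} {γ : ℝ} (h : VonMises F γ)
    (hF : IsDistribFun F) :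
    ∃ C : ℝ, 0 ≤ C ∧ ∃ x₀ : ℝ, 1 < x₀ ∧ (∀ x, x₀ ≤ x → 0 < x * deriv (tailQuantile F) x) ∧
      ∀ a y z r : ℝ, x₀ ≤ a → x₀ ≤ y → y ≤ z → |Real.log y - Real.log a| ≤ r →
        |Real.log z - Real.log a| ≤ r →
        a * deriv (tailQuantile F) a * Real.exp (-(C * r)) * (Real.log z - Real.log y) ≤
          tailQuantile F z - tailQuantile F y ∧
        tailQuantile F z - tailQuantile F y ≤
          a * deriv (tailQuantile F) a * Real.exp (C * r) * (Real.log z - Real.log y) := by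
  obtain ⟨C, hC, x₀, hx₀, hpos, hdiff, hlip⟩ := h.exists_scale_lipschitz hF
  refine ⟨C, hC, x₀, hx₀, hpos, fun a y z r ha hy hyz hry hrz => ?_⟩
  rcases hyz.eq_or_lt with rfl | hyz
  · simp
  have hy0 : 0 < y := by linarith
  have hz0 : 0 < z := by linarith
  have hlog : Real.log y < Real.log z := Real.log_lt_log hy0 hyz
  have hder : ∀ τ, Real.log y ≤ τ → HasDerivAt (fun τ => tailQuantile F (Real.exp τ))
      (Real.exp τ * deriv (tailQuantile F) (Real.exp τ)) τ := by
    intro τ hτ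
    have hτ' : x₀ ≤ Real.exp τ := hy.trans ((Real.log_le_iff_le_exp hy0).1 hτ)
    exact ((hdiff _ hτ').hasDerivAt.comp τ (Real.hasDerivAt_exp τ)).congr_deriv (mul_comm _ _)
  -- Mean value theorem in the logarithmic variable: the increment of U is the scale at e^ξ times
  -- log z - log y, and the Lipschitz bound compares that scale with the one at a.
  obtain ⟨ξ, hξ, hslope⟩ := exists_hasDerivAt_eq_slope (fun τ => tailQuantile F (Real.exp τ))
    (fun τ => Real.exp τ * deriv (tailQuantile F) (Real.exp τ)) hlog
    (fun τ hτ => (hder τ hτ.1).continuousAt.continuousWithinAt) (fun τ hτ => hder τ hτ.1.le)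
  simp only [Real.exp_log hy0, Real.exp_log hz0] at hslope
  have hξ' : x₀ ≤ Real.exp ξ := hy.trans ((Real.log_le_iff_le_exp hy0).1 hξ.1.le)
  have hl0 : 0 < Real.log z - Real.log y := sub_pos.2 hlog
  rw [eq_div_iff hl0.ne'] at hslope
  rw [← hslope]
  have hcξ := hpos _ hξ'
  have hca := hpos _ ha
  have hξr : |ξ - Real.log a| ≤ r := by
    rw [abs_le] at hry hrz ⊢
    constructor <;> linarith [hξ.1, hξ.2]
  have hb := hlip _ _ hξ' ha
  rw [Real.log_exp] at hb
  have hb' := abs_le.1 (hb.trans (mul_le_mul_of_nonneg_left hξr hC))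
  set cξ := Real.exp ξ * deriv (tailQuantile F) (Real.exp ξ)
  set ca := a * deriv (tailQuantile F) a
  have e1 : cξ = Real.exp (Real.log cξ) := (Real.exp_log hcξ).symm
  have e2 : ca = Real.exp (Real.log ca) := (Real.exp_log hca).symm
  constructor
  · refine mul_le_mul_of_nonneg_right ?_ hl0.le
    rw [e1, e2, ← Real.exp_add]
    exact Real.exp_le_exp.2 (by linarith [hb'.1])
  · refine mul_le_mul_of_nonneg_right ?_ hl0.le
    rw [e1, e2, ← Real.exp_add]
    exact Real.exp_le_exp.2 (by linarith [hb'.2])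

/-! ### Spacing of the intermediate levels -/

lemma tendsto_natCast_div_atTop {k : ℕ → ℕ} (hk : Tendsto k atTop atTop)
    (hkN : Tendsto (fun N : ℕ => (k N : ℝ) / N) atTop (𝓝 0)) :
    Tendsto (fun N : ℕ => (N : ℝ) / k N) atTop atTop := by
  have : Tendsto (fun N : ℕ => (k N : ℝ) / N) atTop (𝓝[>] 0) := by
    refine tendsto_nhdsWithin_iff.2 ⟨hkN, ?_⟩
    filter_upwards [hk.eventually_gt_atTop 0, eventually_gt_atTop 0] with N h1 h2
    have h1' : (0 : ℝ) < k N := by exact_mod_cast h1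
    have h2' : (0 : ℝ) < N := by exact_mod_cast h2
    exact div_pos h1' h2'
  refine this.inv_tendsto_nhdsGT_zero.congr fun N => ?_
  simp

/-- The level `t` with `N * (1 - F t) = k - y * √k`. -/
noncomputable def tailLevel (F : ℝ → ℝ) (k : ℕ → ℕ) (y : ℝ) (N : ℕ) : ℝ :=
  tailQuantile F ((N : ℝ) / (k N - y * √(k N : ℝ)))

lemma tailLevel_zero (F : ℝ → ℝ) (k : ℕ → ℕ) (N : ℕ) :
    tailLevel F k 0 N = tailQuantile F ((N : ℝ) / k N) := by
  simp [tailLevel]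

lemma quantile_toReal_eq_tailLevel (F : ℝ → ℝ) (k : ℕ → ℕ) (N : ℕ) :
    (quantile F (1 - (k N : ℝ) / N)).toReal = tailLevel F k 0 N := by
  rw [tailLevel_zero, tailQuantile, one_div_div]

lemma tailLevel_arg_eq {k N y : ℝ} (hk : 0 < k) :
    N / (k - y * √k) = N / k / (1 - y / √k) := by
  have hs : 0 < √k := Real.sqrt_pos.2 hk
  have : k - y * √k = k * (1 - y / √k) := by
    have h2 : √k * √k = k := Real.mul_self_sqrt hk.le
    rw [mul_sub, mul_one, mul_div_assoc']
    congr 1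
    rw [eq_div_iff hs.ne', mul_assoc, h2, mul_comm]
  rw [this, div_div]

lemma tendsto_tailLevel_arg {k : ℕ → ℕ} (hk : Tendsto k atTop atTop)
    (hkN : Tendsto (fun N : ℕ => (k N : ℝ) / N) atTop (𝓝 0)) (y : ℝ) :
    Tendsto (fun N : ℕ => (N : ℝ) / (k N - y * √(k N : ℝ))) atTop atTop := by
  have hsk : Tendsto (fun N => √(k N : ℝ)) atTop atTop :=
    Real.tendsto_sqrt_atTop.comp (tendsto_natCast_atTop_atTop.comp hk)
  have h1 : Tendsto (fun N => (1 - y / √(k N : ℝ))⁻¹) atTop (𝓝 1) := by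
    have := ((hsk.const_div_atTop y).const_sub 1).inv₀ (by simp)
    simpa using this
  refine ((tendsto_natCast_div_atTop hk hkN).atTop_mul_pos one_pos h1).congr' ?_
  filter_upwards [hk.eventually_gt_atTop 0] with N hN
  rw [tailLevel_arg_eq (by exact_mod_cast hN), ← div_eq_mul_inv]

/-- The arguments of U at the two levels differ in logarithm by ℓ = -log(1 - y/√k), and √k ℓ → y.
The increment of U is cℓ up to a factor between e^(-C|ℓ|) and e^(C|ℓ|), which tends to 1. -/
theorem VonMises.tendsto_tailLevel {F : ℝ → ℝ} {γ : ℝ} (h : VonMises F γ)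
    (hF : IsDistribFun F) {k : ℕ → ℕ} (hk : Tendsto k atTop atTop)
    (hkN : Tendsto (fun N : ℕ => (k N : ℝ) / N) atTop (𝓝 0)) (y : ℝ) :
    Tendsto (fun N : ℕ => (tailLevel F k y N - tailLevel F k 0 N) *
      (√(k N : ℝ) / ivtScale F N (k N))) atTop (𝓝 y) := by
  obtain ⟨C, hC, x₀, hx₀, hpos, hinc⟩ := h.exists_increment_bounds hF
  have hsk : Tendsto (fun N => √(k N : ℝ)) atTop atTop :=
    Real.tendsto_sqrt_atTop.comp (tendsto_natCast_atTop_atTop.comp hk)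
  set ℓ : ℕ → ℝ := fun N => -Real.log (1 - y / √(k N : ℝ)) with hℓ
  have hu : Tendsto (fun N => 1 - y / √(k N : ℝ)) atTop (𝓝 1) := by
    simpa using (hsk.const_div_atTop y).const_sub 1
  have hℓ0 : Tendsto ℓ atTop (𝓝 0) := by
    simpa using ((Real.continuousAt_log one_ne_zero).tendsto.comp hu).neg
  have hℓy : Tendsto (fun N => √(k N : ℝ) * ℓ N) atTop (𝓝 y) := by
    have := ((Real.tendsto_mul_log_one_add_div_atTop (-y)).comp hsk).neg
    rw [neg_neg] at this
    refine this.congr fun N => ?_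
    simp only [Function.comp, hℓ, neg_div, ← sub_eq_add_neg]
    ring
  have herr : Tendsto (fun N => (Real.exp (C * |ℓ N|) - 1) * |√(k N : ℝ) * ℓ N|) atTop (𝓝 0) := by
    have h1 : Tendsto (fun N => Real.exp (C * |ℓ N|) - 1) atTop (𝓝 0) := by
      have := (Real.continuous_exp.tendsto _).comp (hℓ0.abs.const_mul C)
      simpa using this.sub_const 1
    simpa using h1.mul hℓy.abs
  suffices hs : Tendsto (fun N : ℕ => (tailLevel F k y N - tailLevel F k 0 N) *
      (√(k N : ℝ) / ivtScale F N (k N)) - √(k N : ℝ) * ℓ N) atTop (𝓝 0) by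
    simpa using hs.add hℓy
  refine squeeze_zero_norm' ?_ herr
  filter_upwards [hk.eventually_gt_atTop 0, eventually_gt_atTop 0,
    (tendsto_natCast_div_atTop hk hkN).eventually_ge_atTop x₀,
    (tendsto_tailLevel_arg hk hkN y).eventually_ge_atTop x₀,
    hu.eventually_const_lt zero_lt_one] with N hkN0 hN0 ha hz hu0
  have hk0 : (0 : ℝ) < k N := by exact_mod_cast hkN0
  have hs0 : 0 < √(k N : ℝ) := Real.sqrt_pos.2 hk0
  have ha0 : 0 < (N : ℝ) / k N := by linarith
  have hlog : Real.log ((N : ℝ) / (k N - y * √(k N : ℝ))) - Real.log ((N : ℝ) / k N) = ℓ N := by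
    rw [tailLevel_arg_eq hk0, Real.log_div ha0.ne' hu0.ne']
    simp [hℓ]
  rw [tailLevel_zero, tailLevel, ivtScale]
  set a := (N : ℝ) / k N
  set z := (N : ℝ) / (k N - y * √(k N : ℝ))
  have hca := hpos a ha
  set c := a * deriv (tailQuantile F) a
  set E := Real.exp (C * |ℓ N|)
  -- From E + 1/E ≥ 2; it makes the lower and upper error bounds symmetric.
  have hE' : 1 - (E - 1) ≤ Real.exp (-(C * |ℓ N|)) := by
    have h1 : Real.exp (-(C * |ℓ N|)) * E = 1 := by rw [← Real.exp_add]; simp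
    have h2 : 0 < E := Real.exp_pos _
    nlinarith [sq_nonneg (E - 1)]
  have hmain : |tailQuantile F z - tailQuantile F a - c * ℓ N| ≤ c * ((E - 1) * |ℓ N|) := by
    rcases le_total a z with haz | hza
    · obtain ⟨h1, h2⟩ := hinc a a z |ℓ N| ha ha haz (by simp) (by rw [hlog])
      rw [hlog] at h1 h2
      have hl : 0 ≤ ℓ N := by
        rw [← hlog]; exact sub_nonneg.2 (Real.log_le_log ha0 haz)
      have hcl : 0 ≤ c * ℓ N := by positivity
      have h3 := mul_le_mul_of_nonneg_left hE' hcl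
      change c * Real.exp (-(C * |ℓ N|)) * _ ≤ _ at h1
      change _ ≤ c * E * _ at h2
      rw [abs_of_nonneg hl, abs_le]
      constructor <;> linarith
    · obtain ⟨h1, h2⟩ := hinc a z a |ℓ N| ha hz hza (by rw [hlog]) (by simp)
      have hlog' : Real.log a - Real.log z = -ℓ N := by rw [← hlog]; ring
      rw [hlog'] at h1 h2
      have hl : 0 ≤ -ℓ N := by
        rw [← hlog']; exact sub_nonneg.2 (Real.log_le_log (by linarith) hza)
      have hcl : 0 ≤ c * (-ℓ N) := by positivity
      have h3 := mul_le_mul_of_nonneg_left hE' hcl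
      change c * Real.exp (-(C * |ℓ N|)) * _ ≤ _ at h1
      change _ ≤ c * E * _ at h2
      rw [abs_of_nonpos (by linarith : ℓ N ≤ 0), abs_le]
      constructor <;> linarith
  have heq : (tailQuantile F z - tailQuantile F a) * (√(k N : ℝ) / c) - √(k N : ℝ) * ℓ N =
      √(k N : ℝ) / c * (tailQuantile F z - tailQuantile F a - c * ℓ N) := by
    field_simp
  rw [Real.norm_eq_abs, heq, abs_mul, abs_of_pos (by positivity : 0 < √(k N : ℝ) / c)]
  calc _ ≤ √(k N : ℝ) / c * (c * ((E - 1) * |ℓ N|)) := by gcongr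
    _ = (E - 1) * (√(k N : ℝ) * |ℓ N|) := by field_simp
    _ = _ := by rw [abs_mul, abs_of_pos hs0]

/-! ### Exceedance counts of the noiseless sample -/

section Marginals

variable {Ω : Type*} [MeasurableSpace Ω] {P : Measure Ω} [IsProbabilityMeasure P]

lemma cdf_map_eq_measureReal {X : Ω → ℝ} (hX : Measurable X) (t : ℝ) :
    cdf (P.map X) t = P.real (X ⁻¹' Iic t) := by
  have := Measure.isProbabilityMeasure_map (μ := P) hX.aemeasurable
  rw [cdf_eq_real, map_measureReal_apply hX measurableSet_Iic]

lemma measureReal_preimage_Ioi {X : Ω → ℝ} (hX : Measurable X) (t : ℝ) :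
    P.real (X ⁻¹' Ioi t) = 1 - cdf (P.map X) t := by
  rw [cdf_map_eq_measureReal hX, ← probReal_compl_eq_one_sub (hX measurableSet_Iic),
    ← preimage_compl, compl_Iic]

lemma measureReal_preimage_Ioc {X : Ω → ℝ} (hX : Measurable X) {a b : ℝ} (hab : a ≤ b) :
    P.real (X ⁻¹' Ioc a b) = cdf (P.map X) b - cdf (P.map X) a := by
  rw [cdf_map_eq_measureReal hX, cdf_map_eq_measureReal hX,
    ← measureReal_sdiff (preimage_mono (Iic_subset_Iic.2 hab)) (hX measurableSet_Iic),
    ← preimage_sdiff]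
  congr 2
  ext x
  simp [and_comm]

/-- Markov's inequality for the number of sample points in a set. -/
lemma measureReal_le_countIn_le {N : ℕ} {X : Fin N → Ω → ℝ} (hX : ∀ i, Measurable (X i))
    {s : Set ℝ} (hs : MeasurableSet s) {q : ℝ} (hq : ∀ i, P.real (X i ⁻¹' s) ≤ q) {δ : ℝ}
    (hδ : 0 < δ) :
    P.real {ω | δ ≤ (countIn (fun i => X i ω) s : ℝ)} ≤ N * q / δ := by
  have hint : ∀ i, Integrable ((X i ⁻¹' s).indicator fun _ => (1 : ℝ)) P := fun i =>
    (integrable_const _).indicator (hX i hs)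
  have heq : (fun ω => (countIn (fun i => X i ω) s : ℝ)) =
      fun ω => ∑ i, (X i ⁻¹' s).indicator (fun _ => (1 : ℝ)) ω := by
    ext ω; rw [countIn_eq_sum]; rfl
  have hmarkov := mul_meas_ge_le_integral_of_nonneg (μ := P)
    (f := fun ω => (countIn (fun i => X i ω) s : ℝ))
    (Eventually.of_forall fun ω => Nat.cast_nonneg _)
    (by rw [heq]; exact integrable_finsetSum _ fun i _ => hint i) δ
  rw [le_div_iff₀ hδ, mul_comm]
  refine hmarkov.trans ?_
  rw [heq, integral_finsetSum _ fun i _ => hint i]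
  calc _ ≤ ∑ _i : Fin N, q := Finset.sum_le_sum fun i _ => by
        rw [integral_indicator_const _ (hX i hs)]; simpa using hq i
    _ = N * q := by simp

end Marginals

lemma IsDistribFun.apply_tailLevel {F : ℝ → ℝ} (hF : IsDistribFun F) (hc : Continuous F)
    {k : ℕ → ℕ} (hk : Tendsto k atTop atTop)
    (hkN : Tendsto (fun N : ℕ => (k N : ℝ) / N) atTop (𝓝 0)) (y : ℝ) :
    ∀ᶠ N in atTop, F (tailLevel F k y N) = 1 - (k N - y * √(k N : ℝ)) / N := by
  filter_upwards [(tendsto_tailLevel_arg hk hkN y).eventually_gt_atTop 1] with N hN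
  rw [tailLevel, hF.apply_tailQuantile hc hN, one_div_div]

/-- The centred and rescaled number of exceedances over the level `F⁻¹(1 - k / N)`. -/
noncomputable def scaledExceedance {Ω : Type*} (F : ℝ → ℝ) (k : ℕ → ℕ) (θ : ℕ → Ω → ℝ)
    (N : ℕ) (ω : Ω) : ℝ :=
  ((countIn (fun i : Fin N => θ i ω) (Ioi (tailLevel F k 0 N)) : ℝ) - k N) / √(k N : ℝ)

section Exceedances

variable {Ω : Type*} [MeasurableSpace Ω] {P : Measure Ω} [IsProbabilityMeasure P] {θ : ℕ → Ω → ℝ}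
  {F : ℝ → ℝ} {k : ℕ → ℕ}

lemma eventually_measureReal_exceed (hθ : ∀ i, Measurable (θ i))
    (hlaw : ∀ i, ⇑(cdf (P.map (θ i))) = F) (hF : IsDistribFun F) (hc : Continuous F)
    (hk : Tendsto k atTop atTop)
    (hkN : Tendsto (fun N : ℕ => (k N : ℝ) / N) atTop (𝓝 0)) :
    ∀ᶠ N in atTop, ∀ i, P.real (θ i ⁻¹' Ioi (tailLevel F k 0 N)) = (k N : ℝ) / N := by
  filter_upwards [hF.apply_tailLevel hc hk hkN 0] with N hN i
  rw [measureReal_preimage_Ioi (hθ i), hlaw, hN]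
  simp

theorem tendstoInDistribution_scaledExceedance (hθ : ∀ i, Measurable (θ i))
    (hind : iIndepFun θ P) (hlaw : ∀ i, ⇑(cdf (P.map (θ i))) = F) (hF : IsDistribFun F)
    (hc : Continuous F) (hk : Tendsto k atTop atTop)
    (hkN : Tendsto (fun N : ℕ => (k N : ℝ) / N) atTop (𝓝 0)) :
    TendstoInDistribution (scaledExceedance F k θ) atTop id (fun _ => P) (gaussianReal 0 1) :=
  tendstoInDistribution_countIn hθ hind (fun _ => measurableSet_Ioi) hk hkN
    (eventually_measureReal_exceed hθ hlaw hF hc hk hkN)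

/-- By Chebyshev: the count has variance at most k, so the probability is at most 1/M², uniformly in
large N. -/
lemma exists_eventually_measure_scaledExceedance_le (hθ : ∀ i, Measurable (θ i))
    (hind : iIndepFun θ P) (hlaw : ∀ i, ⇑(cdf (P.map (θ i))) = F) (hF : IsDistribFun F)
    (hc : Continuous F) (hk : Tendsto k atTop atTop)
    (hkN : Tendsto (fun N : ℕ => (k N : ℝ) / N) atTop (𝓝 0)) {r : ENNReal} (hr : 0 < r) :
    ∃ M : ℝ, ∀ᶠ N in atTop, P {ω | M ≤ |scaledExceedance F k θ N ω|} ≤ r := by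
  have hlim : Tendsto (fun M : ℝ => ENNReal.ofReal (1 / M ^ 2)) atTop (𝓝 0) := by
    have : Tendsto (fun M : ℝ => 1 / M ^ 2) atTop (𝓝 0) :=
      (tendsto_pow_atTop two_ne_zero).const_div_atTop 1
    simpa using ENNReal.tendsto_ofReal this
  obtain ⟨M, hMr, hM0⟩ := ((hlim.eventually_le_const hr).and (eventually_gt_atTop 0)).exists
  refine ⟨M, ?_⟩
  filter_upwards [eventually_measureReal_exceed hθ hlaw hF hc hk hkN, hk.eventually_gt_atTop 0,
    eventually_gt_atTop 0] with N hN hkN0 hN0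
  have hk0 : (0 : ℝ) < k N := by exact_mod_cast hkN0
  have hN' : (N : ℝ) ≠ 0 := by exact_mod_cast hN0.ne'
  have hs : 0 < √(k N : ℝ) := Real.sqrt_pos.2 hk0
  have hcheb := measure_countIn_sub_ge_le (fun i : Fin N => hθ i)
    (hind.precomp (g := fun i : Fin N => (i : ℕ)) Fin.val_injective)
    (measurableSet_Ioi (a := tailLevel F k 0 N)) (fun i => hN i) (mul_pos hM0 hs)
  rw [mul_div_cancel₀ _ hN', mul_pow, Real.sq_sqrt hk0.le] at hcheb
  have e : (k N : ℝ) / (M ^ 2 * k N) = 1 / M ^ 2 := by field_simp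
  rw [e] at hcheb
  refine (measure_mono fun ω hω => ?_).trans (hcheb.trans hMr)
  simp only [mem_ofPred_eq, scaledExceedance] at hω ⊢
  rwa [abs_div, abs_of_pos hs, le_div_iff₀ hs] at hω

/-- The exceedance counts are asymptotically affine in the level. -/
lemma tendsto_measure_exceedance_sub (hθ : ∀ i, Measurable (θ i))
    (hind : iIndepFun θ P) (hlaw : ∀ i, ⇑(cdf (P.map (θ i))) = F) (hF : IsDistribFun F)
    (hc : Continuous F) (hk : Tendsto k atTop atTop)
    (hkN : Tendsto (fun N : ℕ => (k N : ℝ) / N) atTop (𝓝 0)) (y : ℝ) {δ : ℝ} (hδ : 0 < δ) :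
    Tendsto (fun N : ℕ => P {ω | δ ≤
      |((countIn (fun i : Fin N => θ i ω) (Ioi (tailLevel F k y N)) : ℝ) - k N) / √(k N : ℝ) + y
        - scaledExceedance F k θ N ω|}) atTop (𝓝 0) := by
  have hsk : Tendsto (fun N => √(k N : ℝ)) atTop atTop :=
    Real.tendsto_sqrt_atTop.comp (tendsto_natCast_atTop_atTop.comp hk)
  have hlim : Tendsto (fun N => ENNReal.ofReal (|y| / δ ^ 2 / √(k N : ℝ))) atTop (𝓝 0) := by
    simpa using ENNReal.tendsto_ofReal (hsk.const_div_atTop (|y| / δ ^ 2))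
  refine tendsto_of_tendsto_of_tendsto_of_le_of_le' tendsto_const_nhds hlim
    (Eventually.of_forall fun _ => bot_le) ?_
  filter_upwards [hF.apply_tailLevel hc hk hkN 0, hF.apply_tailLevel hc hk hkN y,
    hk.eventually_gt_atTop 0, eventually_gt_atTop 0,
    (tendsto_tailLevel_arg hk hkN 0).eventually_gt_atTop 1,
    (tendsto_tailLevel_arg hk hkN y).eventually_gt_atTop 1] with N h0 hy hkN0 hN0 ha0 hay
  have hk0 : (0 : ℝ) < k N := by exact_mod_cast hkN0
  have hN' : (0 : ℝ) < N := by exact_mod_cast hN0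
  have hs : 0 < √(k N : ℝ) := Real.sqrt_pos.2 hk0
  have hss : √(k N : ℝ) ^ 2 = k N := Real.sq_sqrt hk0.le
  have hpos : ∀ {z : ℝ}, 1 < (N : ℝ) / z → 0 < z := fun {z} h => by
    by_contra hcon
    have := div_nonpos_of_nonneg_of_nonpos hN'.le (not_lt.1 hcon)
    linarith
  -- The number of points between the two levels has mean |y|√k and variance at most |y|√k, so
  -- Chebyshev at distance δ√k gives |y|/(δ²√k). The two signs of y only exchange the levels.
  have key : ∀ a b : ℝ, a ≤ b → F b - F a = |y| * √(k N : ℝ) / N →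
      P {ω | δ * √(k N : ℝ) ≤ |(countIn (fun i : Fin N => θ i ω) (Ioc a b) : ℝ)
        - |y| * √(k N : ℝ)|} ≤ ENNReal.ofReal (|y| / δ ^ 2 / √(k N : ℝ)) := by
    intro a b hab hFab
    have hcheb := measure_countIn_sub_ge_le (fun i : Fin N => hθ i)
      (hind.precomp (g := fun i : Fin N => (i : ℕ)) Fin.val_injective)
      (measurableSet_Ioc (a := a) (b := b)) (q := |y| * √(k N : ℝ) / N)
      (fun i => by rw [measureReal_preimage_Ioc (hθ i) hab, hlaw, hFab]) (mul_pos hδ hs)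
    rw [mul_div_cancel₀ _ hN'.ne'] at hcheb
    refine hcheb.trans (le_of_eq ?_)
    congr 1
    field_simp
  rcases le_total 0 y with hy0 | hy0
  · have hle : tailLevel F k 0 N ≤ tailLevel F k y N := by
      refine hF.tailQuantile_mono ha0 ?_
      have := hpos hay
      gcongr
    refine (measure_mono fun ω hω => ?_).trans
      (key _ _ hle (by rw [h0, hy, abs_of_nonneg hy0]; field_simp; ring))
    simp only [mem_ofPred_eq, scaledExceedance] at hω ⊢
    rw [← le_div_iff₀ hs]
    refine hω.trans (le_of_eq ?_)
    rw [countIn_Ioi_eq_add _ hle, ← abs_of_pos hs, ← abs_div, abs_of_pos hs, abs_of_nonneg hy0,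
      ← abs_neg]
    congr 1
    push_cast
    field_simp
    ring
  · have hle : tailLevel F k y N ≤ tailLevel F k 0 N := by
      refine hF.tailQuantile_mono hay ?_
      have := hpos ha0
      gcongr
    refine (measure_mono fun ω hω => ?_).trans
      (key _ _ hle (by rw [h0, hy, abs_of_nonpos hy0]; field_simp; ring))
    simp only [mem_ofPred_eq, scaledExceedance] at hω ⊢
    rw [← le_div_iff₀ hs]
    refine hω.trans (le_of_eq ?_)
    rw [countIn_Ioi_eq_add _ hle, ← abs_of_pos hs, ← abs_div, abs_of_pos hs, abs_of_nonpos hy0]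
    congr 1
    push_cast
    field_simp
    ring

end Exceedances

/-! ### Stability of exceedance counts under perturbation -/

/-- Perturbing a sample shifts its exceedance counts by at most the number of perturbations that
are larger than the shift of the level. -/
lemma countIn_Ioi_le_add {N : ℕ} {x z : Fin N → ℝ} {a b d : ℝ} (h : a + d ≤ b) :
    countIn x (Ioi b) ≤ countIn z (Ioi a) + countIn (fun i => z i - x i) {w | d < |w|} := by
  classical
  unfold countIn
  refine (Finset.card_le_card (t := (Finset.univ.filter fun i => z i ∈ Ioi a) ∪
    Finset.univ.filter fun i => z i - x i ∈ {w | d < |w|}) fun i hi => ?_).trans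
    (Finset.card_union_le _ _)
  simp only [Finset.mem_filter, Finset.mem_univ, true_and, mem_Ioi, Finset.mem_union,
    mem_ofPred_eq] at hi ⊢
  by_contra! hcon
  linarith [(abs_le.1 hcon.2).1]

lemma countIn_abs_sub_comm {N : ℕ} (x z : Fin N → ℝ) (d : ℝ) :
    countIn (fun i => x i - z i) {w | d < |w|} = countIn (fun i => z i - x i) {w | d < |w|} := by
  classical
  unfold countIn
  simp only [mem_ofPred_eq, abs_sub_comm]

/-- The exceedance counts remain asymptotically affine in the level under perturbations that are
uniformly small up to a negligible number of exceptions. -/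
lemma tendsto_measure_perturbed_exceedance_sub {Ω ι : Type*} [MeasurableSpace Ω] {P : Measure Ω}
    {l : Filter ι} {n κ : ι → ℕ} {X Z : (i : ι) → Fin (n i) → Ω → ℝ} {t : ℝ → ι → ℝ} {c : ι → ℝ}
    {B : ι → Ω → ℝ} (hc : ∀ᶠ i in l, 0 < c i) (hκ : ∀ᶠ i in l, 0 < κ i)
    (ht : ∀ y, Tendsto (fun i => (t y i - t 0 i) * (√(κ i : ℝ) / c i)) l (𝓝 y))
    (hcount : ∀ y δ : ℝ, 0 < δ → Tendsto (fun i => P {ω | δ ≤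
      |((countIn (fun j => X i j ω) (Ioi (t y i)) : ℝ) - κ i) / √(κ i : ℝ) + y - B i ω|}) l (𝓝 0))
    (hnoise : ∀ η : ℝ, 0 < η → Tendsto (fun i => P {ω | η * √(κ i : ℝ) ≤
      (countIn (fun j => Z i j ω - X i j ω) {w | η * (c i / √(κ i : ℝ)) < |w|} : ℝ)}) l (𝓝 0))
    (y : ℝ) {δ : ℝ} (hδ : 0 < δ) :
    Tendsto (fun i => P {ω | δ ≤
      |((countIn (fun j => Z i j ω) (Ioi (t y i)) : ℝ) - κ i) / √(κ i : ℝ) + y - B i ω|})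
      l (𝓝 0) := by
  -- Moving y by 2η eventually moves the level by more than ηc/√κ, enough to absorb a typical
  -- perturbation. The cost is 2η for this shift, η for the count and η for the exceptions.
  set η : ℝ := δ / 4 with hη
  have hη0 : 0 < η := by positivity
  have hsum := ((hcount (y - 2 * η) η hη0).add (hcount (y + 2 * η) η hη0)).add (hnoise η hη0)
  simp only [add_zero] at hsum
  have hd1 : ∀ᶠ i in l, η < (t y i - t 0 i) * (√(κ i : ℝ) / c i)
      - (t (y - 2 * η) i - t 0 i) * (√(κ i : ℝ) / c i) :=
    ((ht y).sub (ht (y - 2 * η))).eventually_const_lt (by linarith)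
  have hd2 : ∀ᶠ i in l, η < (t (y + 2 * η) i - t 0 i) * (√(κ i : ℝ) / c i)
      - (t y i - t 0 i) * (√(κ i : ℝ) / c i) :=
    ((ht (y + 2 * η)).sub (ht y)).eventually_const_lt (by linarith)
  refine tendsto_of_tendsto_of_tendsto_of_le_of_le' tendsto_const_nhds hsum
    (Eventually.of_forall fun _ => bot_le) ?_
  filter_upwards [hc, hκ, hd1, hd2] with i hci hκi h1 h2
  have hs : 0 < √(κ i : ℝ) := Real.sqrt_pos.2 (by exact_mod_cast hκi)
  have hle : ∀ a b : ℝ, η < (b - t 0 i) * (√(κ i : ℝ) / c i) - (a - t 0 i) * (√(κ i : ℝ) / c i) →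
      a + η * (c i / √(κ i : ℝ)) ≤ b := by
    intro a b hab
    rw [← sub_mul, sub_sub_sub_cancel_right] at hab
    have := mul_lt_mul_of_pos_right hab (by positivity : 0 < c i / √(κ i : ℝ))
    have e : (b - a) * (√(κ i : ℝ) / c i) * (c i / √(κ i : ℝ)) = b - a := by field_simp
    linarith
  refine (measure_mono (t := ({ω | η ≤
      |((countIn (fun j => X i j ω) (Ioi (t (y - 2 * η) i)) : ℝ) - κ i) / √(κ i : ℝ) +
        (y - 2 * η) - B i ω|} ∪ {ω | η ≤
      |((countIn (fun j => X i j ω) (Ioi (t (y + 2 * η) i)) : ℝ) - κ i) / √(κ i : ℝ) +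
        (y + 2 * η) - B i ω|}) ∪ {ω | η * √(κ i : ℝ) ≤
      (countIn (fun j => Z i j ω - X i j ω) {w | η * (c i / √(κ i : ℝ)) < |w|} : ℝ)}) ?_).trans
    ((measure_union_le _ _).trans (by gcongr; exact measure_union_le _ _))
  intro ω hω
  by_contra hcon
  simp only [mem_union, mem_ofPred_eq, not_or, not_le] at hcon hω
  obtain ⟨⟨g1, g2⟩, g3⟩ := hcon
  have u1 := countIn_Ioi_le_add (x := fun j => Z i j ω) (z := fun j => X i j ω) (hle _ _ h1)
  have u2 := countIn_Ioi_le_add (x := fun j => X i j ω) (z := fun j => Z i j ω) (hle _ _ h2)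
  rw [countIn_abs_sub_comm] at u1
  rw [← div_lt_iff₀ hs] at g3
  rw [abs_lt] at g1 g2
  have v1 : ((countIn (fun j => Z i j ω) (Ioi (t y i)) : ℝ) - κ i) / √(κ i : ℝ) ≤
      ((countIn (fun j => X i j ω) (Ioi (t (y - 2 * η) i)) : ℝ) - κ i) / √(κ i : ℝ) +
      (countIn (fun j => Z i j ω - X i j ω) {w | η * (c i / √(κ i : ℝ)) < |w|} : ℝ)
        / √(κ i : ℝ) := by
    rw [← add_div]
    gcongr
    have : (countIn (fun j => Z i j ω) (Ioi (t y i)) : ℝ) ≤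
      (countIn (fun j => X i j ω) (Ioi (t (y - 2 * η) i)) : ℝ) +
      (countIn (fun j => Z i j ω - X i j ω) {w | η * (c i / √(κ i : ℝ)) < |w|} : ℝ) := by
      exact_mod_cast u1
    linarith
  have v2 : ((countIn (fun j => X i j ω) (Ioi (t (y + 2 * η) i)) : ℝ) - κ i) / √(κ i : ℝ) ≤
      ((countIn (fun j => Z i j ω) (Ioi (t y i)) : ℝ) - κ i) / √(κ i : ℝ) +
      (countIn (fun j => Z i j ω - X i j ω) {w | η * (c i / √(κ i : ℝ)) < |w|} : ℝ)
        / √(κ i : ℝ) := by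
    rw [← add_div]
    gcongr
    have : (countIn (fun j => X i j ω) (Ioi (t (y + 2 * η) i)) : ℝ) ≤
      (countIn (fun j => Z i j ω) (Ioi (t y i)) : ℝ) +
      (countIn (fun j => Z i j ω - X i j ω) {w | η * (c i / √(κ i : ℝ)) < |w|} : ℝ) := by
      exact_mod_cast u2
    linarith
  have : |((countIn (fun j => Z i j ω) (Ioi (t y i)) : ℝ) - κ i) / √(κ i : ℝ) + y - B i ω|
      < 4 * η := abs_lt.2 ⟨by linarith [g2.1], by linarith [g1.2]⟩
  linarith

/-! ### Uniform order statistics and the tail equivalence conditions -/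

instance isProbabilityMeasure_restrict_Icc_zero_one :
    IsProbabilityMeasure (volume.restrict (Icc (0 : ℝ) 1)) :=
  ⟨by simp⟩

instance isProbabilityMeasure_uniformSample (N : ℕ) : IsProbabilityMeasure (uniformSample N) := by
  unfold uniformSample; infer_instance

lemma measureReal_uniformSample_Iic {N : ℕ} (i : Fin N) {a : ℝ} (h0 : 0 ≤ a) (h1 : a ≤ 1) :
    (uniformSample N).real ((fun x : Fin N → ℝ => x i) ⁻¹' Iic a) = a := by
  have h := (measurePreserving_eval (fun _ : Fin N => volume.restrict (Icc (0 : ℝ) 1))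
    i).measureReal_preimage (s := Iic a) measurableSet_Iic.nullMeasurableSet
  have e : Iic a ∩ Icc (0 : ℝ) 1 = Icc 0 a := by
    ext x; simp only [mem_inter_iff, mem_Iic, mem_Icc]
    constructor
    · rintro ⟨h1, h2, -⟩; exact ⟨h2, h1⟩
    · rintro ⟨h2, h3⟩; exact ⟨h3, h2, h3.trans h1⟩
  unfold uniformSample
  refine h.trans ?_
  rw [measureReal_restrict_apply measurableSet_Iic, e, Real.volume_real_Icc_of_le h0, sub_zero]

lemma measure_uniformSample_countIn_le {N : ℕ} {a : ℝ} (h0 : 0 ≤ a) (h1 : a ≤ 1) {δ : ℝ}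
    (hδ : 0 < δ) :
    uniformSample N {x | δ ≤ |(countIn x (Iic a) : ℝ) - N * a|} ≤
      ENNReal.ofReal (N * a / δ ^ 2) :=
  measure_countIn_sub_ge_le (μ := uniformSample N) (X := fun i (x : Fin N → ℝ) => x i)
    (fun i => measurable_pi_apply i)
    (iIndepFun_pi (X := fun _ x => x) fun _ => aemeasurable_id) measurableSet_Iic
    (fun i => measureReal_uniformSample_Iic i h0 h1) hδ

/-- The `k`-th smallest of `N` uniform variables lies between `k / (2 N)` and `2 k / N` with
probability tending to one. -/
lemma measure_orderStat_uniformSample_le {N k : ℕ} (hk : 0 < k) (hkN : 2 * k ≤ N) :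
    uniformSample N {x | ¬ ((k : ℝ) / N / 2 < orderStat x k ∧ orderStat x k ≤ 2 * ((k : ℝ) / N))} ≤
      ENNReal.ofReal (4 / k) := by
  have hk0 : (0 : ℝ) < k := by exact_mod_cast hk
  have hN0 : (0 : ℝ) < N := by
    have : 0 < N := by omega
    exact_mod_cast this
  have hkN' : 2 * (k : ℝ) ≤ N := by exact_mod_cast hkN
  have ha1 : 2 * ((k : ℝ) / N) ≤ 1 := by rw [mul_div_assoc', div_le_one hN0]; exact hkN'
  have ha0 : 0 < (k : ℝ) / N := by positivity
  have e1 : (N : ℝ) * ((k : ℝ) / N / 2) = k / 2 := by field_simp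
  have e2 : (N : ℝ) * (2 * ((k : ℝ) / N)) = 2 * k := by field_simp
  have c1 := measure_uniformSample_countIn_le (N := N) (a := (k : ℝ) / N / 2) (by positivity)
    (by linarith) (half_pos hk0)
  have c2 := measure_uniformSample_countIn_le (N := N) (a := 2 * ((k : ℝ) / N)) (by positivity)
    ha1 hk0
  rw [e1] at c1
  rw [e2] at c2
  have f1 : (k : ℝ) / 2 / (k / 2) ^ 2 = 2 / k := by field_simp
  have f2 : 2 * (k : ℝ) / k ^ 2 = 2 / k := by field_simp
  rw [f1] at c1
  rw [f2] at c2
  have hsub : {x : Fin N → ℝ | ¬ ((k : ℝ) / N / 2 < orderStat x k ∧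
      orderStat x k ≤ 2 * ((k : ℝ) / N))} ⊆
      {x | (k : ℝ) / 2 ≤ |(countIn x (Iic ((k : ℝ) / N / 2)) : ℝ) - k / 2|} ∪
      {x | (k : ℝ) ≤ |(countIn x (Iic (2 * ((k : ℝ) / N))) : ℝ) - 2 * k|} := by
    intro x hx
    rw [mem_ofPred_eq, not_and_or, not_lt] at hx
    rcases hx with hx | hx
    · left
      rw [orderStat_le_iff x hk (by omega)] at hx
      have hx' : (k : ℝ) ≤ countIn x (Iic ((k : ℝ) / N / 2)) := by exact_mod_cast hx
      exact (by linarith : (k : ℝ) / 2 ≤ countIn x (Iic ((k : ℝ) / N / 2)) - k / 2).trans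
        (le_abs_self _)
    · right
      rw [orderStat_le_iff x hk (by omega), not_le] at hx
      have hx' : (countIn x (Iic (2 * ((k : ℝ) / N))) : ℝ) ≤ k := by exact_mod_cast hx.le
      exact (by linarith : (k : ℝ) ≤ -(countIn x (Iic (2 * ((k : ℝ) / N))) - 2 * k)).trans
        (neg_le_abs _)
  refine (measure_mono hsub).trans ((measure_union_le _ _).trans ((add_le_add c1 c2).trans ?_))
  rw [← ENNReal.ofReal_add (by positivity) (by positivity)]
  exact ENNReal.ofReal_le_ofReal (by rw [← add_div]; norm_num)

lemma EReal.lt_and_lt_of_abs_lt {x : EReal} {δ : ℝ} (h : x.abs < ENNReal.ofReal δ) :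
    ((-δ : ℝ) : EReal) < x ∧ x < (δ : EReal) := by
  induction x with
  | bot => simp at h
  | top => simp at h
  | coe x =>
    rw [EReal.abs_def, ENNReal.ofReal_lt_ofReal_iff_of_nonneg (abs_nonneg x), abs_lt] at h
    exact ⟨EReal.coe_lt_coe_iff.2 h.1, EReal.coe_lt_coe_iff.2 h.2⟩

/-- If the tail supremum is not too small, it is nearly attained at a point with finite
quantiles. -/
lemma exists_of_lt_tailSup {F G : ℝ → ℝ} (hF : IsDistribFun F) (hG : IsDistribFun G)
    {p ε δ v : ℝ} {N T k : ℕ} (hv0 : 0 < v) (hv : v + ε < 1) (hT : 0 < T)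
    (hK : 0 < √(k : ℝ) / ivtScale F N k)
    (h : ((-δ : ℝ) : EReal) < tailSup F G p ε N T k v) :
    ∃ u ∈ Icc (0 : ℝ) ε, ∃ g : ℝ, quantile G u = g ∧
      -δ < √(k : ℝ) / ivtScale F N k * ((quantile F (1 - v - u)).toReal -
        (quantile F (1 - v)).toReal + 1 / (T : ℝ) ^ p * g) := by
  obtain ⟨u, hu⟩ := lt_iSup_iff.1 h
  obtain ⟨hmem, hu⟩ := lt_iSup_iff.1 hu
  have hτ : 0 < 1 / (T : ℝ) ^ p := by
    have : (0 : ℝ) < T := by exact_mod_cast hT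
    positivity
  refine ⟨u, hmem, ?_⟩
  rw [← hF.coe_toReal_quantile (p := 1 - v - u) (by linarith [hmem.2]) (by linarith [hmem.1]),
    ← hF.coe_toReal_quantile (p := 1 - v) (by linarith [hmem.1, hmem.2]) (by linarith)] at hu
  have htop : quantile G u ≠ ⊤ := hG.quantile_ne_top (by linarith [hmem.2])
  generalize quantile G u = g at hu htop
  induction g with
  -- The value -∞ is possible only at u = 0, when G has no finite left endpoint; such a term cannot
  -- exceed -δ.
  | bot =>
    rw [EReal.coe_mul_bot_of_pos hτ, EReal.add_bot, EReal.coe_mul_bot_of_pos hK] at hu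
    exact absurd hu not_lt_bot
  | top => exact absurd rfl htop
  | coe g =>
    refine ⟨g, rfl, ?_⟩
    exact_mod_cast hu

/-- If the tail infimum is not too large, it is nearly attained at a point with finite
quantiles. -/
lemma exists_of_tailInf_lt {F G : ℝ → ℝ} (hF : IsDistribFun F) (hG : IsDistribFun G)
    {p δ v : ℝ} {N T k : ℕ} (hv0 : 0 < v) (hv : v < 1) (hT : 0 < T)
    (hK : 0 < √(k : ℝ) / ivtScale F N k)
    (h : tailInf F G p N T k v < (δ : EReal)) :
    ∃ u ∈ Icc (0 : ℝ) v, ∃ a g : ℝ, quantile F (1 - v + u) = a ∧ quantile G (1 - u) = g ∧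
      √(k : ℝ) / ivtScale F N k * (a - (quantile F (1 - v)).toReal + 1 / (T : ℝ) ^ p * g) < δ := by
  obtain ⟨u, hu⟩ := iInf_lt_iff.1 h
  obtain ⟨hmem, hu⟩ := iInf_lt_iff.1 hu
  have hτ : 0 < 1 / (T : ℝ) ^ p := by
    have : (0 : ℝ) < T := by exact_mod_cast hT
    positivity
  refine ⟨u, hmem, ?_⟩
  rw [← hF.coe_toReal_quantile (p := 1 - v) (by linarith) (by linarith)] at hu
  have hgb : quantile G (1 - u) ≠ ⊥ := hG.quantile_ne_bot (by linarith [hmem.2])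
  have hab : quantile F (1 - v + u) ≠ ⊥ := hF.quantile_ne_bot (by linarith [hmem.1])
  generalize quantile G (1 - u) = g at hu hgb
  generalize quantile F (1 - v + u) = a at hu hab
  induction g with
  | bot => exact absurd rfl hgb
  -- G⁻¹(1) = ∞ can occur at u = 0, and F⁻¹(1) = ∞ at u = v. As neither quantile is -∞, the term is
  -- then +∞ and cannot lie below δ.
  | top =>
    rw [EReal.coe_mul_top_of_pos hτ, EReal.add_top_of_ne_bot, EReal.coe_mul_top_of_pos hK] at hu
    · exact absurd hu not_top_lt
    · induction a with
      | bot => exact absurd rfl hab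
      | top => simp
      | coe a => exact EReal.coe_ne_bot _
  | coe g =>
    induction a with
    | bot => exact absurd rfl hab
    | top =>
      rw [EReal.top_sub_coe, ← EReal.coe_mul, EReal.top_add_coe, EReal.coe_mul_top_of_pos hK] at hu
      exact absurd hu not_top_lt
    | coe a =>
      refine ⟨a, g, rfl, rfl, ?_⟩
      exact_mod_cast hu

lemma quantile_toReal_mono {F : ℝ → ℝ} (hF : IsDistribFun F) {p q : ℝ} (hp : 0 < p) (hpq : p ≤ q)
    (hq : q < 1) : (quantile F p).toReal ≤ (quantile F q).toReal := by
  rw [← EReal.coe_le_coe_iff, hF.coe_toReal_quantile hp (hpq.trans_lt hq),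
    hF.coe_toReal_quantile (hp.trans_le hpq) hq]
  exact quantile_mono F hpq

/-- If the tail supremum and infimum are at most `δ` in absolute value, then they are nearly
attained at points `u₁, u₂` at which the rescaled noise quantiles are at most `δ` and the rescaled
increments of the quantile function of `F` are at most `2 δ`. -/
lemma exists_of_abs_tail_lt {F G : ℝ → ℝ} (hF : IsDistribFun F) (hG : IsDistribFun G)
    {p ε δ v : ℝ} {N T k : ℕ} (hε : ε ∈ Ioo (0 : ℝ) 1) (hv0 : 0 < v) (hv : v + ε < 1) (hT : 0 < T)
    (hK : 0 < √(k : ℝ) / ivtScale F N k)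
    (hsup : (tailSup F G p ε N T k v).abs < ENNReal.ofReal δ)
    (hinf : (tailInf F G p N T k v).abs < ENNReal.ofReal δ) :
    ∃ u₁ ∈ Icc (0 : ℝ) ε, ∃ u₂ ∈ Icc (0 : ℝ) v, ∃ g₁ g₂ a : ℝ,
      quantile G u₁ = g₁ ∧ quantile G (1 - u₂) = g₂ ∧ quantile F (1 - v + u₂) = a ∧
      -δ < √(k : ℝ) / ivtScale F N k * (1 / (T : ℝ) ^ p * g₁) ∧
      √(k : ℝ) / ivtScale F N k * (1 / (T : ℝ) ^ p * g₂) < δ ∧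
      √(k : ℝ) / ivtScale F N k *
        ((quantile F (1 - v)).toReal - (quantile F (1 - v - u₁)).toReal) < 2 * δ ∧
      √(k : ℝ) / ivtScale F N k * (a - (quantile F (1 - v)).toReal) < 2 * δ := by
  obtain ⟨u₁, hu₁, g₁, hg₁, h₁⟩ := exists_of_lt_tailSup hF hG hv0 hv hT hK
    (EReal.lt_and_lt_of_abs_lt hsup).1
  obtain ⟨u₂, hu₂, a, g₂, ha, hg₂, h₂⟩ := exists_of_tailInf_lt hF hG hv0 (by linarith [hε.1]) hT hK
    (EReal.lt_and_lt_of_abs_lt hinf).2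
  refine ⟨u₁, hu₁, u₂, hu₂, g₁, g₂, a, hg₁, hg₂, ha, ?_⟩
  have hτ : 0 < 1 / (T : ℝ) ^ p := by
    have : (0 : ℝ) < T := by exact_mod_cast hT
    positivity
  set K := √(k : ℝ) / ivtScale F N k
  set τ := 1 / (T : ℝ) ^ p
  -- The two conditions are coupled here: u₁ ≤ ε < 1 - v ≤ 1 - u₂. Adding the two inequalities then
  -- bounds the sum of both nonnegative increments of F⁻¹ by 2δ.
  have hg : g₁ ≤ g₂ := by
    rw [← EReal.coe_le_coe_iff, ← hg₁, ← hg₂]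
    exact quantile_mono G (by linarith [hu₁.2, hu₂.2])
  have hb : (quantile F (1 - v - u₁)).toReal ≤ (quantile F (1 - v)).toReal :=
    quantile_toReal_mono hF (by linarith [hu₁.2]) (by linarith [hu₁.1]) (by linarith)
  have ha' : (quantile F (1 - v)).toReal ≤ a := by
    rw [← EReal.coe_le_coe_iff, hF.coe_toReal_quantile (by linarith [hε.1]) (by linarith), ← ha]
    exact quantile_mono F (by linarith [hu₂.1])
  have hgK : K * (τ * g₁) ≤ K * (τ * g₂) := by gcongr
  have hbK : 0 ≤ K * ((quantile F (1 - v)).toReal - (quantile F (1 - v - u₁)).toReal) :=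
    mul_nonneg hK.le (sub_nonneg.2 hb)
  have haK : 0 ≤ K * (a - (quantile F (1 - v)).toReal) := mul_nonneg hK.le (sub_nonneg.2 ha')
  rw [mul_add] at h₁ h₂
  have e : K * ((quantile F (1 - v - u₁)).toReal - (quantile F (1 - v)).toReal) =
      -(K * ((quantile F (1 - v)).toReal - (quantile F (1 - v - u₁)).toReal)) := by ring
  rw [e] at h₁
  refine ⟨by linarith, by linarith, by linarith, by linarith⟩

lemma abs_log_sub_log_le {x a : ℝ} (ha : 0 < a) (h1 : a / 4 ≤ x) (h2 : x ≤ 4 * a) :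
    |Real.log x - Real.log a| ≤ Real.log 4 := by
  have hx : 0 < x := by linarith
  have l1 := Real.log_le_log (by positivity) h1
  have l2 := Real.log_le_log hx h2
  rw [Real.log_div ha.ne' (by norm_num)] at l1
  rw [Real.log_mul (by norm_num) ha.ne'] at l2
  rw [abs_le]
  constructor <;> linarith

/-- Under the von Mises condition, increments of the quantile function near `1 - 1 / a` grow at
least linearly. -/
theorem VonMises.exists_quantile_gap {F : ℝ → ℝ} {γ : ℝ} (h : VonMises F γ)
    (hF : IsDistribFun F) :
    ∃ κ : ℝ, 0 < κ ∧ ∃ a₀ : ℝ, 1 < a₀ ∧ ∀ a, a₀ ≤ a → 0 < a * deriv (tailQuantile F) a ∧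
      ∀ v w : ℝ, 1 / a / 2 < v → v ≤ 2 * (1 / a) → 0 ≤ w → w ≤ v / 2 →
        a * deriv (tailQuantile F) a * κ * (w * a) ≤
          (quantile F (1 - v)).toReal - (quantile F (1 - v - w)).toReal ∧
        a * deriv (tailQuantile F) a * κ * (w * a) ≤
          (quantile F (1 - v + w)).toReal - (quantile F (1 - v)).toReal := by
  obtain ⟨C, hC, x₀, hx₀, hpos, hinc⟩ := h.exists_increment_bounds hF
  -- All arguments s that occur satisfy 1/4 ≤ s a ≤ 3, so 1/s is within a factor 4 of a; this
  -- explains log 4 and 4x₀. The 1/3 comes from log((s + d)/s) ≥ d/(s + d) ≥ d a/3.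
  refine ⟨Real.exp (-(C * Real.log 4)) / 3, by positivity, 4 * x₀, by linarith,
    fun a ha => ⟨hpos a (by linarith), fun v w hv1 hv2 hw0 hw => ?_⟩⟩
  have ha0 : 0 < a := by linarith
  have hca := hpos a (by linarith)
  have hq : ∀ s : ℝ, (quantile F (1 - s)).toReal = tailQuantile F (1 / s) := by
    intro s; rw [tailQuantile, one_div_one_div]
  have hv0 : 0 < v := lt_trans (by positivity) hv1
  have hva : 1 / 2 < v * a := by
    have := mul_lt_mul_of_pos_right hv1 ha0
    have e : 1 / a / 2 * a = 1 / 2 := by field_simp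
    linarith
  have hva2 : v * a ≤ 2 := by
    have := mul_le_mul_of_nonneg_right hv2 ha0.le
    have e : 2 * (1 / a) * a = 2 := by field_simp
    linarith
  have hwa : w * a ≤ v * a / 2 := by
    have := mul_le_mul_of_nonneg_right hw ha0.le
    linarith
  have hwa0 : 0 ≤ w * a := by positivity
  have hrange : ∀ s : ℝ, 0 < s → 1 / 4 ≤ s * a → s * a ≤ 4 →
      x₀ ≤ 1 / s ∧ |Real.log (1 / s) - Real.log a| ≤ Real.log 4 := by
    intro s hs h1 h2
    have l1 : a / 4 ≤ 1 / s := by rw [le_div_iff₀ hs]; linarith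
    have l2 : 1 / s ≤ 4 * a := by rw [div_le_iff₀ hs]; linarith
    exact ⟨by linarith, abs_log_sub_log_le ha0 l1 l2⟩
  have hgap : ∀ s d : ℝ, 0 < s → 0 ≤ d → 1 / 4 ≤ s * a → (s + d) * a ≤ 3 →
      a * deriv (tailQuantile F) a * (Real.exp (-(C * Real.log 4)) / 3) * (d * a) ≤
        tailQuantile F (1 / s) - tailQuantile F (1 / (s + d)) := by
    intro s d hs hd h1 h2
    have hsd : 0 < s + d := by linarith
    have hda : 0 ≤ d * a := by positivity
    obtain ⟨r1, r2⟩ := hrange s hs h1 (by linarith)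
    obtain ⟨r3, r4⟩ := hrange (s + d) hsd (by linarith) (by linarith)
    refine le_trans ?_ (hinc a (1 / (s + d)) (1 / s) (Real.log 4) (by linarith) r3
      (by gcongr; linarith) r4 r2).1
    have hlog : d * a / 3 ≤ Real.log (1 / s) - Real.log (1 / (s + d)) := by
      have h3 := Real.one_sub_inv_le_log_of_pos (div_pos hsd hs)
      rw [Real.log_div hsd.ne' hs.ne', inv_div] at h3
      have e : Real.log (1 / s) - Real.log (1 / (s + d)) = Real.log (s + d) - Real.log s := by
        rw [one_div, one_div, Real.log_inv, Real.log_inv]; ring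
      rw [e]
      refine le_trans ?_ h3
      have e2 : 1 - s / (s + d) = d / (s + d) := by field_simp; ring
      rw [e2, le_div_iff₀ hsd]
      nlinarith
    calc _ = a * deriv (tailQuantile F) a * Real.exp (-(C * Real.log 4)) * (d * a / 3) := by ring
      _ ≤ _ := by gcongr
  constructor
  · rw [sub_sub, hq, hq]
    exact hgap v w hv0 hw0 (by linarith) (by linarith)
  · have e : 1 - v + w = 1 - (v - w) := by ring
    rw [e, hq, hq]
    have := hgap (v - w) w (by linarith) hw0 (by linarith) (by linarith)
    rwa [sub_add_cancel] at this

lemma tendsto_measure_orderStat_uniformSample {k : ℕ → ℕ} (hk : Tendsto k atTop atTop)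
    (hkN : Tendsto (fun N : ℕ => (k N : ℝ) / N) atTop (𝓝 0)) :
    Tendsto (fun N => uniformSample N {x | ¬ ((k N : ℝ) / N / 2 < orderStat x (k N) ∧
      orderStat x (k N) ≤ 2 * ((k N : ℝ) / N))}) atTop (𝓝 0) := by
  have hkr : Tendsto (fun N => (k N : ℝ)) atTop atTop := tendsto_natCast_atTop_atTop.comp hk
  have hlim : Tendsto (fun N => ENNReal.ofReal (4 / (k N : ℝ))) atTop (𝓝 0) := by
    simpa using ENNReal.tendsto_ofReal (hkr.const_div_atTop 4)
  refine tendsto_of_tendsto_of_tendsto_of_le_of_le' tendsto_const_nhds hlim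
    (Eventually.of_forall fun _ => bot_le) ?_
  filter_upwards [hk.eventually_gt_atTop 0, eventually_gt_atTop 0,
    hkN.eventually_le_const (by norm_num : (0 : ℝ) < 1 / 2)] with N h1 h2 h3
  have hN0 : (0 : ℝ) < N := by exact_mod_cast h2
  rw [div_le_iff₀ hN0] at h3
  have h4 : ((2 * k N : ℕ) : ℝ) ≤ N := by push_cast; linarith
  exact measure_orderStat_uniformSample_le h1 (by exact_mod_cast h4)

/-- The tail equivalence conditions force the rescaled noise quantiles at levels of order
`o(√k / N)` from `0` and `1` to be negligible. -/
theorem IVTTailEquivalence.exists_noise_quantiles {F : ℝ → ℝ} {G : ℕ → ℝ → ℝ} {p γ : ℝ}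
    {k : ℕ → ℕ} {l : Filter (ℕ × ℕ)} (h : IVTTailEquivalence F G p k l) (hvM : VonMises F γ)
    (hF : IsDistribFun F) (hG : ∀ T, IsDistribFun (G T)) (hl : l ≤ atTop ×ˢ atTop)
    (hk : Tendsto k atTop atTop) (hkN : Tendsto (fun N : ℕ => (k N : ℝ) / N) atTop (𝓝 0)) :
    ∃ A : ℝ, 0 < A ∧ ∀ δ : ℝ, 0 < δ → ∀ᶠ q : ℕ × ℕ in l, 0 < ivtScale F q.1 (k q.1) ∧
      ∃ u₁ u₂ g₁ g₂ : ℝ, 0 ≤ u₁ ∧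
        quantile (G q.2) u₁ = g₁ ∧ quantile (G q.2) (1 - u₂) = g₂ ∧
        -δ < √(k q.1 : ℝ) / ivtScale F q.1 (k q.1) * (1 / (q.2 : ℝ) ^ p * g₁) ∧
        √(k q.1 : ℝ) / ivtScale F q.1 (k q.1) * (1 / (q.2 : ℝ) ^ p * g₂) < δ ∧
        u₁ + u₂ ≤ A * δ * √(k q.1 : ℝ) / q.1 := by
  obtain ⟨κ, hκ, a₀, ha₀, hgap⟩ := hvM.exists_quantile_gap hF
  obtain ⟨ε, hε, hsup⟩ := h.sup
  refine ⟨4 / κ, by positivity, fun δ hδ => ?_⟩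
  have hfst : Tendsto Prod.fst l atTop := tendsto_fst.mono_left hl
  have hsnd : Tendsto Prod.snd l atTop := tendsto_snd.mono_left hl
  have hsk : Tendsto (fun N => √(k N : ℝ)) atTop atTop :=
    Real.tendsto_sqrt_atTop.comp (tendsto_natCast_atTop_atTop.comp hk)
  have hsum := ((hsup δ hδ).add (h.inf δ hδ)).add
    ((tendsto_measure_orderStat_uniformSample hk hkN).comp hfst)
  simp only [add_zero] at hsum
  filter_upwards [hsum.eventually_lt_const zero_lt_one,
    hfst.eventually ((tendsto_natCast_div_atTop hk hkN).eventually_ge_atTop a₀),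
    hfst.eventually (hkN.eventually_lt_const (half_pos (sub_pos.2 hε.2))),
    hfst.eventually (hk.eventually_gt_atTop 0), hfst.eventually (eventually_gt_atTop 0),
    hsnd.eventually (eventually_gt_atTop 0),
    hfst.eventually (hsk.eventually_gt_atTop (8 * δ / κ))] with q hq ha hkε hk0' hN0' hT hbig
  obtain ⟨N, T⟩ := q
  simp only [Function.comp] at *
  have hk0 : (0 : ℝ) < k N := by exact_mod_cast hk0'
  have hN0 : (0 : ℝ) < N := by exact_mod_cast hN0'
  have hs : 0 < √(k N : ℝ) := Real.sqrt_pos.2 hk0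
  have hss : √(k N : ℝ) * √(k N : ℝ) = k N := Real.mul_self_sqrt hk0.le
  obtain ⟨hc, hgap⟩ := hgap _ ha
  have hc' : 0 < ivtScale F N (k N) := hc
  have hK : 0 < √(k N : ℝ) / ivtScale F N (k N) := by positivity
  -- The three exceptional events have total probability below 1, so some realisation avoids them
  -- all. One realisation suffices, because the conclusion is deterministic.
  obtain ⟨x, hx⟩ : ∃ x : Fin N → ℝ, ¬ (ENNReal.ofReal δ ≤
      (tailSup F (G T) p ε N T (k N) (orderStat x (k N))).abs) ∧ ¬ (ENNReal.ofReal δ ≤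
      (tailInf F (G T) p N T (k N) (orderStat x (k N))).abs) ∧
      ((k N : ℝ) / N / 2 < orderStat x (k N) ∧ orderStat x (k N) ≤ 2 * ((k N : ℝ) / N)) := by
    by_contra hcon
    push Not at hcon
    have huniv : (univ : Set (Fin N → ℝ)) ⊆ ({x | ENNReal.ofReal δ ≤
      (tailSup F (G T) p ε N T (k N) (orderStat x (k N))).abs} ∪ {x | ENNReal.ofReal δ ≤
      (tailInf F (G T) p N T (k N) (orderStat x (k N))).abs}) ∪
      {x | ¬ ((k N : ℝ) / N / 2 < orderStat x (k N) ∧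
        orderStat x (k N) ≤ 2 * ((k N : ℝ) / N))} := by
      intro x _
      simp only [mem_union, mem_ofPred_eq]
      by_contra hx
      push Not at hx
      exact absurd (hcon x hx.1.1 hx.1.2 hx.2.1) (not_lt.2 hx.2.2)
    have h1 := (measure_mono (μ := uniformSample N) huniv).trans ((measure_union_le _ _).trans
      (add_le_add (measure_union_le _ _) le_rfl))
    rw [measure_univ] at h1
    exact absurd hq (not_lt.2 h1)
  obtain ⟨hx1, hx2, hv1, hv2⟩ := hx
  generalize orderStat x (k N) = v at hx1 hx2 hv1 hv2
  have hv0 : 0 < v := lt_trans (by positivity) hv1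
  obtain ⟨u₁, hu₁, u₂, hu₂, g₁, g₂, a, hg₁, hg₂, haq, hb1, hb2, hb3, hb4⟩ :=
    exists_of_abs_tail_lt hF (hG T) hε hv0 (by linarith) hT hK (not_le.1 hx1) (not_le.1 hx2)
  refine ⟨hc', u₁, u₂, g₁, g₂, hu₁.1, hg₁, hg₂, hb1, hb2, ?_⟩
  have hinv : 1 / ((N : ℝ) / k N) = k N / N := one_div_div _ _
  rw [hinv] at hgap
  -- a rescaled increment below `2 δ` bounds the increment of the argument
  have hsmall : ∀ u D : ℝ, 0 ≤ u →
      √(k N : ℝ) / ivtScale F N (k N) * D < 2 * δ →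
      ivtScale F N (k N) * κ * (min u (v / 2) * (N / k N)) ≤ D →
      u ≤ 2 * δ / κ * √(k N : ℝ) / N := by
    intro u D hu hD hle
    have h1 := (mul_le_mul_of_nonneg_left hle hK.le).trans_lt hD
    have e : √(k N : ℝ) / ivtScale F N (k N) * (ivtScale F N (k N) * κ *
        (min u (v / 2) * (N / k N))) = κ * N * min u (v / 2) / √(k N : ℝ) := by
      field_simp
      rw [pow_two, hss, mul_comm]
    rw [e, div_lt_iff₀ hs] at h1
    have h2 : min u (v / 2) < 2 * δ / κ * √(k N : ℝ) / N := by
      rw [lt_div_iff₀ hN0, div_mul_eq_mul_div, lt_div_iff₀ hκ]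
      linarith
    -- The gap estimate holds only up to v/2, hence the truncated increment. Since √k > 8δ/κ and v >
    -- k/(2N), the bound obtained lies below v/2, so the minimum must be u.
    have h3 : 2 * δ / κ * √(k N : ℝ) / N < v / 2 := by
      have : 8 * δ / κ * √(k N : ℝ) < k N := by
        calc _ < √(k N : ℝ) * √(k N : ℝ) := by gcongr
          _ = _ := hss
      have h4 : 2 * δ / κ * √(k N : ℝ) / N < k N / N / 4 := by
        rw [div_div, mul_comm (N : ℝ) 4, ← div_div, div_lt_div_iff_of_pos_right hN0]
        have e : 8 * δ / κ * √(k N : ℝ) = 4 * (2 * δ / κ * √(k N : ℝ)) := by ring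
        linarith
      linarith
    rcases min_lt_iff.1 h2 with h5 | h5
    · exact h5.le
    · linarith
  have hu1 : u₁ ≤ 2 * δ / κ * √(k N : ℝ) / N := by
    refine hsmall u₁ _ hu₁.1 hb3 ?_
    refine (hgap v (min u₁ (v / 2)) hv1 hv2 (le_min hu₁.1 (by positivity)) (min_le_right _ _)).1.trans
      ?_
    refine sub_le_sub_left (quantile_toReal_mono hF (by linarith [hu₁.2])
      (by linarith [min_le_left u₁ (v / 2)]) ?_) _
    linarith [le_min hu₁.1 (by positivity : 0 ≤ v / 2)]
  have hu2 : u₂ ≤ 2 * δ / κ * √(k N : ℝ) / N := by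
    refine hsmall u₂ _ hu₂.1 hb4 ?_
    refine (hgap v (min u₂ (v / 2)) hv1 hv2 (le_min hu₂.1 (by positivity)) (min_le_right _ _)).2.trans
      ?_
    refine sub_le_sub_right ?_ _
    have hm0 : 0 ≤ min u₂ (v / 2) := le_min hu₂.1 (by positivity)
    rw [← EReal.coe_le_coe_iff, hF.coe_toReal_quantile (by linarith [hε.1])
      (by linarith [min_le_right u₂ (v / 2)]), ← haq]
    exact quantile_mono F (by linarith [min_le_left u₂ (v / 2)])
  calc u₁ + u₂ ≤ 2 * δ / κ * √(k N : ℝ) / N + 2 * δ / κ * √(k N : ℝ) / N := add_le_add hu1 hu2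
    _ = _ := by ring

/-! ### Counting the large noise terms -/

section Noise

variable {Ω : Type*} [MeasurableSpace Ω] {P : Measure Ω} [IsProbabilityMeasure P]

/-- P(X < g) is the left limit of the distribution function at g, whose values strictly below the
u-quantile are at most u. The open half-line leaves out a possible atom at g. -/
lemma measureReal_preimage_Iio_le {X : Ω → ℝ} (hX : Measurable X) {u g : ℝ} (hu : 0 ≤ u)
    (h : quantile (cdf (P.map X)) u = g) : P.real (X ⁻¹' Iio g) ≤ u := by
  have := Measure.isProbabilityMeasure_map (μ := P) hX.aemeasurable
  have h1 := (cdf (P.map X)).measure_Iio (tendsto_cdf_atBot _) g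
  rw [measure_cdf, sub_zero] at h1
  rw [← map_measureReal_apply hX measurableSet_Iio, measureReal_def, h1]
  refine ENNReal.toReal_le_of_le_ofReal hu (ENNReal.ofReal_le_ofReal ?_)
  refine le_of_tendsto ((monotone_cdf (P.map X)).tendsto_leftLim g) ?_
  filter_upwards [self_mem_nhdsWithin] with x hx
  exact apply_le_of_lt_quantile hu (by rw [h]; exact EReal.coe_lt_coe_iff.2 hx)

lemma measureReal_scaled_tail_le {X : Ω → ℝ} (hX : Measurable X) {u₁ u₂ g₁ g₂ τ d : ℝ}
    (hτ : 0 < τ) (hu : 0 ≤ u₁) (h₁ : quantile (cdf (P.map X)) u₁ = g₁)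
    (h₂ : quantile (cdf (P.map X)) (1 - u₂) = g₂) (hd₁ : -d ≤ τ * g₁) (hd₂ : τ * g₂ ≤ d) :
    P.real ((fun ω => τ * X ω) ⁻¹' {w | d < |w|}) ≤ u₁ + u₂ := by
  have hsub : (fun ω => τ * X ω) ⁻¹' {w | d < |w|} ⊆ X ⁻¹' Iio g₁ ∪ X ⁻¹' Ioi g₂ := by
    intro ω hω
    rcases lt_abs.1 (show d < |τ * X ω| from hω) with h | h
    · right
      exact lt_of_mul_lt_mul_left (hd₂.trans_lt h) hτ.le
    · left
      exact lt_of_mul_lt_mul_left ((by linarith : τ * X ω < -d).trans_le hd₁) hτ.le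
  refine (measureReal_mono hsub).trans ((measureReal_union_le _ _).trans (add_le_add
    (measureReal_preimage_Iio_le hX hu h₁) ?_))
  rw [measureReal_preimage_Ioi hX]
  linarith [(isDistribFun_cdf (P.map X)).le_apply_of_quantile_le h₂.le]

/-- Under the tail equivalence conditions all but `o(√k)` noise variables are negligible. -/
theorem IVTTailEquivalence.tendsto_measure_noise {F : ℝ → ℝ} {G : ℕ → ℝ → ℝ} {p γ : ℝ}
    {k : ℕ → ℕ} {l : Filter (ℕ × ℕ)} (h : IVTTailEquivalence F G p k l) (hvM : VonMises F γ)
    (hF : IsDistribFun F) (hl : l ≤ atTop ×ˢ atTop)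
    (hk : Tendsto k atTop atTop) (hkN : Tendsto (fun N : ℕ => (k N : ℝ) / N) atTop (𝓝 0))
    {ε : ℕ → ℕ → Ω → ℝ} (hε : ∀ T i, Measurable (ε T i))
    (hG : ∀ T i, G T = cdf (P.map (ε T i))) {η : ℝ} (hη : 0 < η) :
    Tendsto (fun q : ℕ × ℕ => P {ω | η * √(k q.1 : ℝ) ≤
      (countIn (fun i : Fin q.1 => 1 / (q.2 : ℝ) ^ p * ε q.2 i ω)
        {w | η * (ivtScale F q.1 (k q.1) / √(k q.1 : ℝ)) < |w|} : ℝ)}) l (𝓝 0) := by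
  obtain ⟨A, hA, hnoise⟩ := h.exists_noise_quantiles hvM hF
    (fun T => by rw [hG T 0]; exact isDistribFun_cdf _) hl hk hkN
  have hfst : Tendsto Prod.fst l atTop := tendsto_fst.mono_left hl
  have hsnd : Tendsto Prod.snd l atTop := tendsto_snd.mono_left hl
  rw [ENNReal.tendsto_nhds_zero]
  intro r hr
  obtain ⟨r', hr'0, hr'⟩ : ∃ r' : ℝ, 0 < r' ∧ ENNReal.ofReal r' ≤ r := by
    rcases eq_or_ne r ⊤ with rfl | hrt
    · exact ⟨1, one_pos, le_top⟩
    · exact ⟨r.toReal, ENNReal.toReal_pos hr.ne' hrt, ENNReal.ofReal_toReal_le⟩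
  -- δ ≤ η places both noise quantiles within the threshold ηc/√k; δ ≤ ηr'/A makes the Markov bound
  -- N · (Aδ√k/N)/(η√k) = Aδ/η at most r'.
  set δ := min η (η * r' / A) with hδ
  have hδ0 : 0 < δ := lt_min hη (by positivity)
  have hδA : A * δ ≤ η * r' := by
    have := min_le_right η (η * r' / A)
    rw [le_div_iff₀ hA] at this
    linarith
  filter_upwards [hnoise δ hδ0, hfst.eventually (hk.eventually_gt_atTop 0),
    hfst.eventually (eventually_gt_atTop 0), hsnd.eventually (eventually_gt_atTop 0)]
    with q hq hk0' hN0' hT'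
  obtain ⟨N, T⟩ := q
  simp only at *
  obtain ⟨hc, u₁, u₂, g₁, g₂, hu, h₁, h₂, hb₁, hb₂, hle⟩ := hq
  have hs : 0 < √(k N : ℝ) := Real.sqrt_pos.2 (by exact_mod_cast hk0')
  have hN0 : (0 : ℝ) < N := by exact_mod_cast hN0'
  have hT0 : (0 : ℝ) < T := by exact_mod_cast hT'
  have hτ : 0 < 1 / (T : ℝ) ^ p := by positivity
  set c := ivtScale F N (k N)
  set τ := 1 / (T : ℝ) ^ p
  have hδη : δ * (c / √(k N : ℝ)) ≤ η * (c / √(k N : ℝ)) := by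
    have := min_le_left η (η * r' / A)
    gcongr
  have hb₁' : -(η * (c / √(k N : ℝ))) ≤ τ * g₁ := by
    have := mul_lt_mul_of_pos_right hb₁ (by positivity : 0 < c / √(k N : ℝ))
    have e : √(k N : ℝ) / c * (τ * g₁) * (c / √(k N : ℝ)) = τ * g₁ := by field_simp
    linarith
  have hb₂' : τ * g₂ ≤ η * (c / √(k N : ℝ)) := by
    have := mul_lt_mul_of_pos_right hb₂ (by positivity : 0 < c / √(k N : ℝ))
    have e : √(k N : ℝ) / c * (τ * g₂) * (c / √(k N : ℝ)) = τ * g₂ := by field_simp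
    linarith
  have hms : MeasurableSet {w : ℝ | η * (c / √(k N : ℝ)) < |w|} :=
    measurableSet_lt measurable_const measurable_id.abs
  have hmarkov := measureReal_le_countIn_le (P := P) (N := N)
    (X := fun i ω => τ * ε T i ω) (fun i => (hε T i).const_mul τ) hms
    (q := A * δ * √(k N : ℝ) / N)
    (fun i => (measureReal_scaled_tail_le (hε T i) hτ hu (by rw [← hG T i]; exact h₁)
      (by rw [← hG T i]; exact h₂) hb₁' hb₂').trans hle) (mul_pos hη hs)
  refine (ENNReal.le_ofReal_iff_toReal_le (measure_ne_top _ _) hr'0.le).2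
    (hmarkov.trans ?_) |>.trans hr'
  rw [mul_div_cancel₀ _ hN0.ne', mul_div_mul_right _ _ hs.ne', div_le_iff₀ hη]
  linarith

end Noise

/-! ### The main theorem -/

theorem theorem5 {Ω : Type*} [MeasurableSpace Ω] (P : Measure Ω) [IsProbabilityMeasure P]
    -- the latent variables `θ i` and the noise `ε T i` for individual sample size `T`
    (θ : ℕ → Ω → ℝ) (ε : ℕ → ℕ → Ω → ℝ) (p : ℝ) (hp : 0 < p)
    (hθ : ∀ i, Measurable (θ i)) (hε : ∀ T i, Measurable (ε T i))
    -- for each `T`, the vectors `(θ i, ε T i)` are independent and identically distributed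
    (hindep : ∀ T, iIndepFun (fun i ω => (θ i ω, ε T i ω)) P)
    (hident : ∀ T i, IdentDistrib (fun ω => (θ i ω, ε T i ω)) (fun ω => (θ 0 ω, ε T 0 ω)) P P)
    -- `F` is the distribution function of `θ i`, and `G T` is the one of `ε T i`
    (F : ℝ → ℝ) (hF : F = cdf (P.map (θ 0)))
    (G : ℕ → ℝ → ℝ) (hG : ∀ T, G T = cdf (P.map (ε T 0)))
    (γ : ℝ) (hvM : VonMises F γ) (hmono : DensityEventuallyMonotone F)
    -- an intermediate sequence
    (k : ℕ → ℕ) (hk : Tendsto k atTop atTop)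
    (hkN : Tendsto (fun N : ℕ => (k N : ℝ) / N) atTop (𝓝 0)) :
    -- (1) the noiseless statistic
    TendstoInDistribution (fun (N : ℕ) (ω : Ω) => ivtStatistic F (fun i : Fin N => θ i ω) (k N))
      atTop id (fun _ => P) (gaussianReal 0 1) ∧
    -- (2) the noisy statistic, in any regime `l` in which `N, T → ∞`
    ∀ l : Filter (ℕ × ℕ), l.IsCountablyGenerated → l ≤ atTop ×ˢ atTop →
      IVTTailEquivalence F G p k l →
      IVTTailEquivalence F G p (fun N => k N + ⌊√(k N : ℝ)⌋₊) l →
      TendstoInDistribution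
        (fun (q : ℕ × ℕ) (ω : Ω) =>
          ivtStatistic F (fun i : Fin q.1 => θ i ω + 1 / (q.2 : ℝ) ^ p * ε q.2 i ω) (k q.1))
        l id (fun _ => P) (gaussianReal 0 1) := by
  have hindθ : iIndepFun θ P := (hindep 0).comp (fun _ => Prod.fst) fun _ => measurable_fst
  have hlaw : ∀ i, ⇑(cdf (P.map (θ i))) = F := fun i => by
    have h : P.map (θ i) = P.map (θ 0) := ((hident 0 i).comp measurable_fst).map_eq
    rw [hF, h]
  have hGi : ∀ T i, G T = cdf (P.map (ε T i)) := fun T i => by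
    have h : P.map (ε T i) = P.map (ε T 0) := ((hident T i).comp measurable_snd).map_eq
    rw [hG T, h]
  have hFd : IsDistribFun F := by rw [hF]; exact isDistribFun_cdf _
  have hcont := hvM.continuous
  have hscale : ∀ᶠ N : ℕ in atTop, 0 < ivtScale F N (k N) := by
    obtain ⟨_, _, a₀, _, hgap⟩ := hvM.exists_quantile_gap hFd
    filter_upwards [(tendsto_natCast_div_atTop hk hkN).eventually_ge_atTop a₀] with N hN
    exact (hgap _ hN).1
  have hB := tendstoInDistribution_scaledExceedance hθ hindθ hlaw hFd hcont hk hkN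
  have htight := fun (r : ENNReal) (hr : 0 < r) =>
    exists_eventually_measure_scaledExceedance_le hθ hindθ hlaw hFd hcont hk hkN hr
  have hlevel := fun y => hvM.tendsto_tailLevel hFd hk hkN y
  have hcount := fun (y δ : ℝ) (hδ : 0 < δ) =>
    tendsto_measure_exceedance_sub hθ hindθ hlaw hFd hcont hk hkN y hδ
  refine ⟨?_, fun l _ hl hIVT _ => ?_⟩
  · refine tendstoInDistribution_ivtStatistic (n := fun N => N) (fun N i => hθ i)
      (t := tailLevel F k) (B := scaledExceedance F k θ) hscale tendsto_id hk hkN ?_ hcount htight hB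
    simpa only [quantile_toReal_eq_tailLevel] using hlevel
  · have hfst : Tendsto Prod.fst l atTop := tendsto_fst.mono_left hl
    -- The same B, built from the θ's alone, serves the noisy sample; its limit law is pulled back
    -- along the projection to N.
    have hB' : TendstoInDistribution (fun q : ℕ × ℕ => scaledExceedance F k θ q.1) l id
        (fun _ => P) (gaussianReal 0 1) :=
      ⟨fun q => hB.forall_aemeasurable q.1, hB.aemeasurable_limit, hB.tendsto.comp hfst⟩
    have hk0 : ∀ᶠ q : ℕ × ℕ in l, 0 < k q.1 := hfst.eventually (hk.eventually_gt_atTop 0)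
    refine tendstoInDistribution_ivtStatistic (n := fun q : ℕ × ℕ => q.1)
      (κ := fun q => k q.1) (X := fun q i ω => θ i ω + 1 / (q.2 : ℝ) ^ p * ε q.2 i ω)
      (fun q i => (hθ i).add ((hε q.2 i).const_mul _))
      (t := fun y q => tailLevel F k y q.1) (c := fun q => ivtScale F q.1 (k q.1))
      (B := fun q => scaledExceedance F k θ q.1) (hfst.eventually hscale) hfst
      (hk.comp hfst) (hkN.comp hfst) ?_ ?_ ?_ hB'
    · simp only [quantile_toReal_eq_tailLevel]
      exact fun y => (hlevel y).comp hfst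
    · intro y δ hδ
      refine tendsto_measure_perturbed_exceedance_sub (n := fun q : ℕ × ℕ => q.1)
        (κ := fun q => k q.1) (X := fun q i ω => θ i ω) (t := fun y q => tailLevel F k y q.1)
        (c := fun q => ivtScale F q.1 (k q.1)) (B := fun q => scaledExceedance F k θ q.1)
        (hfst.eventually hscale) hk0 (fun y => (hlevel y).comp hfst)
        (fun y δ hδ => (hcount y δ hδ).comp hfst) (fun η hη => ?_) y hδ
      -- The perturbation is exactly T^(-p) ε, and its large values are counted by Markov's
      -- inequality from the marginal law of ε alone.
      simp only [add_sub_cancel_left]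
      exact hIVT.tendsto_measure_noise hvM hFd hl hk hkN hε hGi hη
    · intro r hr
      obtain ⟨M, hM⟩ := htight r hr
      exact ⟨M, hfst.eventually hM⟩
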